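/- A finite bidirected graph $B$ consists of a finite loopless multigraph with vertex set $V(B)$ and edge set $E(B)$ together with a sign $\sigma(e,u)\in\{+,-\}$ for every edge $e$ and every endpoint $u$ of $e$. A trail in $B$ is a sequence $v_0 e_1 v_1 \dots e_\ell v_\ell$ of vertices and pairwise distinct edges such that $e_i$ has endpoints $v_{i-1}$ and $v_i$ for $1\le i\le \ell$, and $\sigma(e_{i+1},v_i)=-\sigma(e_i,v_i)$ for $1\le i<\ell$; it is nontrivial if $\ell\ge 1$. A path is a trail that does not repeat vertices, and an almost path is a trail that is trivial or becomes a path when its last edge and last vertex are omitted. For vertices $r \neq v$ and $\alpha\in\{+,-\}$, let $\kappa_B^\alpha(r,v)$ be the maximum number of distinct, pairwise internally vertex-disjoint paths from $r$ to $v$ whose last edge has sign $\alpha$ at $v$. Let $r\in V(B)$. Then $B$, rooted at $r$, is clean if there is no nontrivial almost path from $r$ to $r$ in $B$, and $B$ is a vertex-flame if $$|E(B)|\le \sum_{v\in V(B)\setminus\{r\}}\ \sum_{\alpha\in\{+,-\}}\kappa_B^\alpha(r,v).$$ Theorem. Every finite bidirected graph $B$ rooted at $r$ that is clean has a spanning subgraph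 $F$ (that is, $V(F)=V(B)$, $E(F)\subseteq E(B)$, with endpoints and signs inherited from $B$) such that $F$, rooted at $r$, is a vertex-flame and $\kappa_F^\alpha(r,v)=\kappa_B^\alpha(r,v)$ for every $v\in V(B)\setminus\{r\}$ and every $\alpha\in\{+,-\}$. -/

import Mathlib

open scoped Graph

/-- A finite bidirected graph: a finite loopless multigraph together with a signing of its
half-edges, i.e. of the pairs `(e, u)` where `u` is an endpoint of the edge `e`. The signs `+` and
`-` are the elements `1` and `-1` of `ℤˣ`. -/
structure BidirectedGraph (α β : Type*) where
  /-- The underlying multigraph. -/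
  graph : Graph α β
  loopless : graph.Loopless
  finite_vertexSet : V(graph).Finite
  finite_edgeSet : E(graph).Finite
  /-- The signing of the half-edges. -/
  sign : {h : β × α // graph.Inc h.1 h.2} → ℤˣ

/-- An oriented edge `(e, u, v)`, with underlying edge `e`, tail `u` and head `v`. -/
structure OrientedEdge (α β : Type*) where
  edge : β
  tail : α
  head : α

/-- A sequence `v₀ e₁ v₁ e₂ … e_ℓ v_ℓ`, recorded by its initial vertex `v₀` and its list of oriented
edges; for a trail the further vertices are the heads of these oriented edges. -/
structure TrailSeq (α β : Type*) where
  start : α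
  steps : List (OrientedEdge α β)

namespace TrailSeq

variable {α β : Type*}

/-- The list of vertices `v₀, v₁, …, v_ℓ`. -/
def vertices (T : TrailSeq α β) : List α :=
  T.start :: T.steps.map OrientedEdge.head

/-- The list of underlying edges `e₁, …, e_ℓ`. -/
def edges (T : TrailSeq α β) : List β :=
  T.steps.map OrientedEdge.edge

/-- The terminal vertex `v_ℓ`. -/
def terminal (T : TrailSeq α β) : α :=
  (T.steps.getLast?.map OrientedEdge.head).getD T.start

/-- The list of internal vertices `v₁, …, v_{ℓ-1}`. -/
def interior (T : TrailSeq α β) : List α :=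
  T.steps.dropLast.map OrientedEdge.head

/-- The sequence obtained by omitting the last edge and the last vertex (if there is an edge). -/
def dropLastEdge (T : TrailSeq α β) : TrailSeq α β :=
  ⟨T.start, T.steps.dropLast⟩

/-- Two sequences have no common internal vertex. -/
def InternallyDisjoint (P Q : TrailSeq α β) : Prop :=
  P.interior.Disjoint Q.interior

end TrailSeq

namespace BidirectedGraph

variable {α β : Type*}

/-- `(e, u)` is a half-edge of `B`, and `e` has sign `s` at `u`. -/
def HasSign (B : BidirectedGraph α β) (e : β) (u : α) (s : ℤˣ) : Prop :=
  ∃ h : B.graph.Inc e u, B.sign ⟨(e, u), h⟩ = s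

/-- `T` is a trail in `B`: consecutive vertices are joined by the oriented edges in between, at every
internal vertex the sign changes, and no edge is repeated. -/
structure IsTrail (B : BidirectedGraph α β) (T : TrailSeq α β) : Prop where
  start_mem : T.start ∈ V(B.graph)
  isLink : ∀ f ∈ T.steps, B.graph.IsLink f.edge f.tail f.head
  start_eq : ∀ f ∈ T.steps.head?, f.tail = T.start
  chain : T.steps.IsChain fun f g =>
    g.tail = f.head ∧ ∃ s : ℤˣ, B.HasSign f.edge f.head s ∧ B.HasSign g.edge f.head (-s)
  edges_nodup : T.edges.Nodup

/-- A path is a trail that does not repeat vertices. -/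
def IsPath (B : BidirectedGraph α β) (T : TrailSeq α β) : Prop :=
  B.IsTrail T ∧ T.vertices.Nodup

/-- An almost path is a trail that is trivial or becomes a path by omitting its last edge. -/
def IsAlmostPath (B : BidirectedGraph α β) (T : TrailSeq α β) : Prop :=
  B.IsTrail T ∧ (T.steps = [] ∨ B.IsPath T.dropLastEdge)

/-- `B`, rooted at `r`, is clean: there is no nontrivial `r`--`r` almost path. -/
def IsClean (B : BidirectedGraph α β) (r : α) : Prop :=
  ¬ ∃ T : TrailSeq α β, B.IsAlmostPath T ∧ T.steps ≠ [] ∧ T.start = r ∧ T.terminal = r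

/-- `T` is an `x`--`(y, s)` path: a path from `x` to `y` whose last edge has sign `s` at `y`. -/
def IsSignedPath (B : BidirectedGraph α β) (x y : α) (s : ℤˣ) (T : TrailSeq α β) : Prop :=
  B.IsPath T ∧ T.start = x ∧ ∃ f ∈ T.steps.getLast?, f.head = y ∧ B.HasSign f.edge y s

/-- The signed local vertex-connectivity: the maximum number of (distinct) pairwise internally
vertex-disjoint `x`--`(y, s)` paths. As `B` is finite, the supremum is a maximum. -/
noncomputable def kappa (B : BidirectedGraph α β) (s : ℤˣ) (x y : α) : ℕ :=
  sSup {n : ℕ | ∃ P : Finset (TrailSeq α β),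
    (∀ T ∈ P, B.IsSignedPath x y s T) ∧
    (P : Set (TrailSeq α β)).Pairwise TrailSeq.InternallyDisjoint ∧ P.card = n}

/-- `B`, rooted at `r`, is a vertex-flame: the number of its edges is at most the sum of
`kappa s r v` over all vertices `v ≠ r` and both signs `s`. -/
def IsVertexFlame (B : BidirectedGraph α β) (r : α) : Prop :=
  E(B.graph).ncard ≤
    ∑ v ∈ (B.finite_vertexSet.sdiff (t := {r})).toFinset, ∑ s : ℤˣ, B.kappa s r v

/-- `F` is a spanning subgraph of `B`: it has the same vertices, its edges are edges of `B` with the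
same endpoints, and its half-edges have the same sign as in `B`. -/
structure IsSpanningSubgraph (F B : BidirectedGraph α β) : Prop where
  graph_le : F.graph.IsSpanningSubgraph B.graph
  sign_eq : ∀ (e : β) (u : α) (s : ℤˣ), F.HasSign e u s → B.HasSign e u s

end BidirectedGraph

/-! Split every vertex `v ≠ r` into two halves `(v, +)` and `(v, -)`, and treat every edge at `r` as
a separate source. If the two halves of a vertex are regarded as matched, paths from `r` become
alternating paths from unmatched sources, and cleanness says that there is no augmenting path
(`noAugmenting`). Edmonds' theory of blossoms applies.

A vertex that can be left through both halves lies in a blossom. Every walk to it passes through the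
base of that blossom, so for each sign at most one disjoint path arrives
(`BlossomStructure.linkage_le_one`), and one does; the vertex contributes 2 to the sum. The blossoms
are grown by ears. An ear with `ℓ ≥ 1` new vertices has `ℓ + 1 ≤ 2ℓ` edges, so two edges per blossom
vertex suffice inside the blossoms (`exists_blossomStructure`).

Contracting the blossoms onto their bases leaves a digraph on the sources and the spine, the
vertices that can be left through exactly one half. Here a system of disjoint paths to `w` is
encoded by a transversal of the sets `{b m} ∪ N⁻(m)`: a vertex on a path takes its predecessor,
every other vertex takes its own base, and the last bases before `w` are in-neighbours of `w` that
are missed (`BlossomStructure.exists_transversal`). Conversely, following a transversal backwards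
from missed in-neighbours yields disjoint walks (`BlossomStructure.hasLinkage_inNbrs`). A smallest
set of arcs that does not lower the numbers of in-neighbours that can be missed has in-degrees equal
to these numbers; this is an exchange along alternating paths (`IsTransversal.exists_avoid`,
`exists_thin_arcs`). One edge per remaining arc, together with the blossom edges, is the required
subgraph (`exists_sparse_edges`). -/

/-! ### Transversals and the thinning of arcs. -/

section Transversal

open Finset Classical

variable {ι ν : Type*}

/-- Following the alternating path through `v` in the union of two injections. -/
theorem exists_alternating_set (X : Finset ι) (f g : ι → ν) (hf : Set.InjOn f X)
    (hg : Set.InjOn g X) {v : ι} (hv : v ∈ X) :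
    ∃ S ⊆ X, v ∈ S ∧ ∃ y, (∀ x ∈ X, x ≠ v → g x ≠ y) ∧ y ∈ S.image f ∧
      S.image f = insert y ((S.erase v).image g) ∧
      ∀ x ∈ S, ∀ x' ∈ X, f x = g x' → x' ∈ S := by
  let C : Finset ι → Prop := fun S => S ⊆ X ∧ v ∈ S ∧ ∀ x ∈ S, ∀ x' ∈ X, f x = g x' → x' ∈ S
  have hC : ∃ S, C S := ⟨X, subset_rfl, hv, fun _ _ _ h _ => h⟩
  -- The smallest closed set is the alternating path from `v`: an `x ≠ v` in it with `g x ∉ f(S)`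
  -- could be deleted.
  obtain ⟨S, hS, hmin⟩ : ∃ S, C S ∧ ∀ S', C S' → S.card ≤ S'.card := by
    obtain ⟨S, hS, h⟩ := WellFounded.has_min (measure (fun S : Finset ι => S.card)).wf
      {S | C S} hC
    exact ⟨S, hS, fun S' h' => not_lt.1 (h S' h')⟩
  obtain ⟨hSX, hvS, hcl⟩ := hS
  have hsub : (S.erase v).image g ⊆ S.image f := by
    intro z hz
    obtain ⟨x, hx, rfl⟩ := mem_image.1 hz
    obtain ⟨hxv, hxS⟩ := mem_erase.1 hx
    by_contra hn
    have : C (S.erase x) := by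
      refine ⟨(erase_subset _ _).trans hSX, mem_erase.2 ⟨hxv.symm, hvS⟩, ?_⟩
      intro a ha a' ha' h
      refine mem_erase.2 ⟨?_, hcl a (mem_of_mem_erase ha) a' ha' h⟩
      rintro rfl
      exact hn (mem_image.2 ⟨a, mem_of_mem_erase ha, h⟩)
    have h1 := hmin _ this
    have h2 := card_erase_lt_of_mem hxS
    omega
  have hcf : (S.image f).card = S.card := card_image_of_injOn (hf.mono hSX)
  have hcg : ((S.erase v).image g).card = S.card - 1 := by
    rw [card_image_of_injOn (hg.mono ((erase_subset _ _).trans hSX)), card_erase_of_mem hvS]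
  have hpos : 0 < S.card := card_pos.2 ⟨v, hvS⟩
  have hd : (S.image f \ (S.erase v).image g).card = 1 := by
    rw [card_sdiff_of_subset hsub]; omega
  obtain ⟨y, hy⟩ := card_eq_one.1 hd
  have hy' : y ∈ S.image f \ (S.erase v).image g := by rw [hy]; simp
  rw [mem_sdiff] at hy'
  refine ⟨S, hSX, hvS, y, ?_, hy'.1, ?_, hcl⟩
  · rintro x hx hxv rfl
    obtain ⟨a, ha, hax⟩ := mem_image.1 hy'.1
    exact hy'.2 (mem_image.2 ⟨x, mem_erase.2 ⟨hxv, hcl a ha x hx hax⟩, rfl⟩)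
  · rw [← sdiff_union_of_subset hsub, hy]; rfl

/-- A transversal of the sets `{b m} ∪ {n | (n, m) ∈ A}`, `m ∈ X`. -/
def IsTransversal (X : Finset ι) (b : ι → ν) (A : Finset (ν × ι)) (f : ι → ν) : Prop :=
  Set.InjOn f X ∧ ∀ m ∈ X, f m = b m ∨ (f m, m) ∈ A

/-- The in-neighbours of `w` with respect to a set of arcs. -/
noncomputable def inNbrs (A : Finset (ν × ι)) (w : ι) : Finset ν :=
  (A.filter (fun a => a.2 = w)).image Prod.fst

theorem mem_inNbrs {A : Finset (ν × ι)} {w : ι} {n : ν} : n ∈ inNbrs A w ↔ (n, w) ∈ A := by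
  simp [inNbrs]

theorem card_eq_sum_card_inNbrs [Fintype ι] (A : Finset (ν × ι)) :
    A.card = ∑ i, (inNbrs A i).card := by
  rw [Finset.card_eq_sum_card_fiberwise (t := Finset.univ) (f := Prod.snd) (by simp)]
  refine Finset.sum_congr rfl fun i _ => ?_
  rw [inNbrs, Finset.card_image_of_injOn]
  intro a ha a' ha' e
  simp only [Finset.coe_filter, Set.mem_ofPred_eq] at ha ha'
  exact Prod.ext e (ha.2.trans ha'.2.symm)

/-- The elements `n` with `(n, w) ∈ A` which `f` does not attain on `X`. -/
noncomputable def missed (X : Finset ι) (A : Finset (ν × ι)) (f : ι → ν) (w : ι) : Finset ν :=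
  (inNbrs A w).filter (fun n => n ∉ X.image f)

theorem mem_missed {X : Finset ι} {A : Finset (ν × ι)} {f : ι → ν} {w : ι} {n : ν} :
    n ∈ missed X A f w ↔ (n, w) ∈ A ∧ ∀ m ∈ X, f m ≠ n := by
  simp [missed, mem_inNbrs]

/-- Exchanging `g` for `b` along the alternating path from `w` changes the image only by gaining the
end `y` of the path and losing `g w`. Unless `g w = b w` already, `g w` is an in-neighbour of `w`,
so it makes up for the possible loss of `y`. -/
theorem IsTransversal.exists_fix {X : Finset ι} {b : ι → ν} {A : Finset (ν × ι)} {g : ι → ν}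
    (hb : Set.InjOn b X) (hg : IsTransversal X b A g) {w : ι} (hw : w ∈ X) :
    ∃ f, IsTransversal X b A f ∧ f w = b w ∧
      (missed X A g w).card ≤ (missed X A f w).card := by
  by_cases hgw : g w = b w
  · exact ⟨g, hg, hgw, le_rfl⟩
  have hgA : (g w, w) ∈ A := (hg.2 w hw).resolve_left hgw
  obtain ⟨S, hSX, hwS, y, hyg, hyS, hSy, -⟩ := exists_alternating_set X b g hb hg.1 hw
  have key : ∀ x ∈ S, b x = y ∨ ∃ x' ∈ S, x' ≠ w ∧ g x' = b x := by
    intro x hx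
    have : b x ∈ insert y ((S.erase w).image g) := hSy ▸ mem_image_of_mem b hx
    rcases mem_insert.1 this with h | h
    · exact .inl h
    · obtain ⟨x', hx', h⟩ := mem_image.1 h
      exact .inr ⟨x', mem_of_mem_erase hx', ne_of_mem_erase hx', h⟩
  have cross : ∀ x ∈ S, ∀ x' ∈ X, x' ∉ S → b x ≠ g x' := by
    intro x hx x' hx' hx'S h
    rcases key x hx with h1 | ⟨x'', hx'', hne, h1⟩
    · exact hyg x' hx' (fun h' => hx'S (h' ▸ hwS)) (h.symm.trans h1)
    · exact hx'S (hg.1 (hSX hx'') hx' (h1.trans h) ▸ hx'')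
  refine ⟨fun x => if x ∈ S then b x else g x, ⟨?_, ?_⟩, by simp [hwS], ?_⟩
  · intro x hx x' hx' h
    by_cases h1 : x ∈ S <;> by_cases h2 : x' ∈ S <;> simp only [h1, h2, if_true, if_false] at h
    · exact hb hx hx' h
    · exact absurd h (cross x h1 x' hx' h2)
    · exact absurd h.symm (cross x' h2 x hx h1)
    · exact hg.1 hx hx' h
  · intro m hm
    by_cases h1 : m ∈ S
    · simp [h1]
    · simpa [h1] using hg.2 m hm
  · have hmiss : ∀ n ∈ missed X A g w, n ≠ y ∨ y = g w →
        n ∈ missed X A (fun x => if x ∈ S then b x else g x) w := by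
      intro n hn hny
      rw [mem_missed] at hn ⊢
      refine ⟨hn.1, fun m hm h => ?_⟩
      by_cases h1 : m ∈ S
      · simp only [h1, if_true] at h
        rcases key m h1 with h2 | ⟨x', hx', hne, h2⟩
        · rcases hny with hny | hny
          · exact hny (h.symm.trans h2)
          · exact hn.2 w hw (hny.symm.trans (h2.symm.trans h))
        · exact hn.2 x' (hSX hx') (h2.trans h)
      · simp only [h1, if_false] at h
        exact hn.2 m hm h
    by_cases hyw : y = g w
    · exact card_le_card fun n hn => hmiss n hn (.inr hyw)
    have hsub : insert (g w) ((missed X A g w).erase y) ⊆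
        missed X A (fun x => if x ∈ S then b x else g x) w := by
      intro n hn
      rcases mem_insert.1 hn with rfl | hn
      · rw [mem_missed]
        refine ⟨hgA, fun m hm h => ?_⟩
        by_cases h1 : m ∈ S
        · simp only [h1, if_true] at h
          rcases key m h1 with h2 | ⟨x', hx', hne, h2⟩
          · exact hyw (h2.symm.trans h)
          · exact hne (hg.1 (hSX hx') hw (h2.trans h))
        · simp only [h1, if_false] at h
          exact h1 (hg.1 hm hw h ▸ hwS)
      · exact hmiss n (mem_of_mem_erase hn) (.inl (ne_of_mem_erase hn))
    refine le_trans ?_ (card_le_card hsub)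
    rw [card_insert_of_notMem]
    · exact Nat.sub_le_iff_le_add.1 pred_card_le_card_erase
    · intro h
      exact (mem_missed.1 (mem_of_mem_erase h)).2 w hw rfl

/-- If `g` misses as many in-neighbours of `v` as possible, then an arc from an in-neighbour of `v`
attained by `g` can be avoided by transversals without changing their image. -/
theorem IsTransversal.exists_avoid {X : Finset ι} {b : ι → ν} {A : Finset (ν × ι)} {f g : ι → ν}
    (hf : IsTransversal X b A f) (hg : IsTransversal X b A g) {v : ι} (hv : v ∈ X) {u : ν}
    (hgv : g v ≠ u) (hu : u ∈ X.image g) (huA : (u, v) ∈ A)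
    (hmax : ∀ h, IsTransversal X b A h → (missed X A h v).card ≤ (missed X A g v).card) :
    ∃ f', IsTransversal X b A f' ∧ f' v ≠ u ∧ X.image f' = X.image f := by
  by_cases hfv : f v = u
  swap
  · exact ⟨f, hf, hfv, rfl⟩
  obtain ⟨S, hSX, hvS, y, hyg, hyS, hSy, hcl⟩ := exists_alternating_set X f g hf.1 hg.1 hv
  obtain ⟨x₀, hx₀, hgx₀⟩ := mem_image.1 hu
  have hx₀v : x₀ ≠ v := by rintro rfl; exact hgv hgx₀
  have hyu : y ≠ u := fun h => hyg x₀ hx₀ hx₀v (hgx₀.trans h.symm)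
  have key : ∀ x ∈ S, f x = y ∨ ∃ x' ∈ S, x' ≠ v ∧ g x' = f x := by
    intro x hx
    have : f x ∈ insert y ((S.erase v).image g) := hSy ▸ mem_image_of_mem f hx
    rcases mem_insert.1 this with h | h
    · exact .inl h
    · obtain ⟨x', hx', h⟩ := mem_image.1 h
      exact .inr ⟨x', mem_of_mem_erase hx', ne_of_mem_erase hx', h⟩
  have key' : ∀ x ∈ S, x ≠ v → ∃ x' ∈ S, f x' = g x := by
    intro x hx hxv
    have : g x ∈ S.image f := by
      rw [hSy]; exact mem_insert_of_mem (mem_image_of_mem g (mem_erase.2 ⟨hxv, hx⟩))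
    exact mem_image.1 this
  -- The value `y` is admissible at `v`. Otherwise exchange `g` for `f` on `S` without `v`: the
  -- image loses `u` and gains `y`, which is no in-neighbour of `v`, so more in-neighbours are
  -- missed than the maximum.
  have hy : y = b v ∨ (y, v) ∈ A := by
    by_cases hyv : y = g v
    · rw [hyv]; exact hg.2 v hv
    by_contra hcon
    push Not at hcon
    have hyX : ∀ x ∈ X, g x ≠ y := by
      intro x hx
      by_cases h : x = v
      · subst h; exact fun h => hyv h.symm
      · exact hyg x hx h
    let h₁ : ι → ν := fun x => if x ∈ S ∧ x ≠ v then f x else g x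
    have cross : ∀ x ∈ S, x ≠ v → ∀ x' ∈ X, ¬ (x' ∈ S ∧ x' ≠ v) → f x ≠ g x' := by
      intro x hx hxv x' hx' hx'S h
      have h1 := hcl x hx x' hx' h
      have h2 : x' = v := by by_contra h2; exact hx'S ⟨h1, h2⟩
      subst h2
      rcases key x hx with h3 | ⟨x'', hx'', hne, h3⟩
      · exact hyv (h3.symm.trans h)
      · exact hne (hg.1 (hSX hx'') hx' (h3.trans h))
    have ht : IsTransversal X b A h₁ := by
      refine ⟨?_, ?_⟩
      · intro x hx x' hx' h
        by_cases c1 : x ∈ S ∧ x ≠ v <;> by_cases c2 : x' ∈ S ∧ x' ≠ v <;>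
          simp only [h₁, c1, c2, if_true, if_false, ne_eq, not_false_eq_true, and_self] at h
        · exact hf.1 hx hx' h
        · exact absurd h (cross x c1.1 c1.2 x' hx' c2)
        · exact absurd h.symm (cross x' c2.1 c2.2 x hx c1)
        · exact hg.1 hx hx' h
      · intro m hm
        by_cases c1 : m ∈ S ∧ m ≠ v
        · simpa [h₁, c1] using hf.2 m hm
        · simpa only [h₁, c1, if_false] using hg.2 m hm
    have hsub : insert u (missed X A g v) ⊆ missed X A h₁ v := by
      intro n hn
      rw [mem_missed]
      have aux : ∀ m ∈ X, m ∈ S → m ≠ v → n ≠ u → n ∈ missed X A g v → f m ≠ n := by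
        intro m hm hmS hmv hnu hn h
        rcases key m hmS with h3 | ⟨x'', hx'', hne, h3⟩
        · exact hcon.2 (by rw [← h3, h]; exact (mem_missed.1 hn).1)
        · exact (mem_missed.1 hn).2 x'' (hSX hx'') (h3.trans h)
      by_cases hnu : n = u
      · subst hnu
        refine ⟨huA, fun m hm h => ?_⟩
        by_cases c1 : m ∈ S ∧ m ≠ v
        · simp only [h₁, c1, if_true, ne_eq, not_false_eq_true, and_self] at h
          exact c1.2 (hf.1 hm hv (h.trans hfv.symm))
        · simp only [h₁, c1, if_false] at h
          have : m = x₀ := hg.1 hm hx₀ (h.trans hgx₀.symm)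
          subst this
          exact c1 ⟨hcl v hvS _ hm (hfv.trans hgx₀.symm), hx₀v⟩
      · have hn' := (mem_insert.1 hn).resolve_left hnu
        refine ⟨(mem_missed.1 hn').1, fun m hm h => ?_⟩
        by_cases c1 : m ∈ S ∧ m ≠ v
        · simp only [h₁, c1, if_true, ne_eq, not_false_eq_true, and_self] at h
          exact aux m hm c1.1 c1.2 hnu hn' h
        · simp only [h₁, c1, if_false] at h
          exact (mem_missed.1 hn').2 m hm h
    have h2 := card_le_card hsub
    rw [card_insert_of_notMem (fun h => (mem_missed.1 h).2 x₀ hx₀ hgx₀)] at h2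
    have h3 := hmax h₁ ht
    omega
  -- Since `f(S) = {y} ∪ g(S \ {v})`, this reassigns the values of `f` on `S` and keeps the image.
  let f' : ι → ν := fun x => if x = v then y else if x ∈ S then g x else f x
  have hf'v : f' v = y := by simp [f']
  have hf'S : ∀ x ∈ S, x ≠ v → f' x = g x := fun x hx hxv => by simp [f', hx, hxv]
  have hf'n : ∀ x, x ∉ S → f' x = f x := fun x hx => by
    have : x ≠ v := fun h => hx (h ▸ hvS)
    simp [f', hx, this]
  have himg : X.image f' = X.image f := by
    ext n
    simp only [mem_image]
    constructor
    · rintro ⟨x, hx, rfl⟩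
      by_cases hxS : x ∈ S
      · by_cases hxv : x = v
        · subst hxv
          obtain ⟨a, ha, hay⟩ := mem_image.1 hyS
          exact ⟨a, hSX ha, hay.trans hf'v.symm⟩
        · obtain ⟨x', hx', h⟩ := key' x hxS hxv
          exact ⟨x', hSX hx', h.trans (hf'S x hxS hxv).symm⟩
      · exact ⟨x, hx, (hf'n x hxS).symm⟩
    · rintro ⟨x, hx, rfl⟩
      by_cases hxS : x ∈ S
      · rcases key x hxS with h | ⟨x', hx', hne, h⟩
        · exact ⟨v, hv, hf'v.trans h.symm⟩
        · exact ⟨x', hSX hx', (hf'S x' hx' hne).trans h⟩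
      · exact ⟨x, hx, hf'n x hxS⟩
  refine ⟨f', ⟨?_, ?_⟩, hf'v ▸ hyu, himg⟩
  · apply injOn_of_card_image_eq
    rw [himg, card_image_of_injOn hf.1]
  · intro m hm
    by_cases hmS : m ∈ S
    · by_cases hmv : m = v
      · subst hmv; rw [hf'v]; exact hy
      · rw [hf'S m hmS hmv]; exact hg.2 m hm
    · rw [hf'n m hmS]; exact hf.2 m hm

/-- The sets of arcs can be thinned out so that for every `w` all in-neighbours are missed by one
transversal fixing `w`, while the numbers of in-neighbours that can be missed do not drop. -/
theorem exists_thin_arcs {X : Finset ι} {b : ι → ν} (hb : Set.InjOn b X) (A₀ : Finset (ν × ι))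
    (hA₀ : ∀ m, (b m, m) ∉ A₀) :
    ∃ A ⊆ A₀, ∀ w ∈ X,
      (∃ f, IsTransversal X b A f ∧ f w = b w ∧ ∀ n, (n, w) ∈ A → n ∈ missed X A f w) ∧
      ∀ f, IsTransversal X b A₀ f →
        (missed X A₀ f w).card ≤ (inNbrs A w).card := by
  let Q : Finset (ν × ι) → Prop := fun A => A ⊆ A₀ ∧ ∀ w ∈ X, ∀ f, IsTransversal X b A₀ f →
    ∃ f', IsTransversal X b A f' ∧ (missed X A₀ f w).card ≤ (missed X A f' w).card
  obtain ⟨A, hA, hmin⟩ : ∃ A, Q A ∧ ∀ A', Q A' → A.card ≤ A'.card := by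
    obtain ⟨A, hA, h⟩ := WellFounded.has_min (measure (fun A : Finset (ν × ι) => A.card)).wf
      {A | Q A} ⟨A₀, subset_rfl, fun w _ f hf => ⟨f, hf, le_rfl⟩⟩
    exact ⟨A, hA, fun A' h' => not_lt.1 (h A' h')⟩
  refine ⟨A, hA.1, fun w hw => ⟨?_, ?_⟩⟩
  · have hex : ∃ g, IsTransversal X b A g ∧
        ∀ h, IsTransversal X b A h → (missed X A h w).card ≤ (missed X A g w).card := by
      let P : ℕ → Prop := fun k => ∃ g, IsTransversal X b A g ∧ (missed X A g w).card = k
      have hP : ∃ k, P k := ⟨_, b, ⟨hb, fun m _ => .inl rfl⟩, rfl⟩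
      have hbd : ∀ k, P k → k ≤ (inNbrs A w).card := by
        rintro k ⟨g, -, rfl⟩; exact card_le_card (filter_subset _ _)
      obtain ⟨g, hg, hgk⟩ := Nat.findGreatest_spec (hbd _ hP.choose_spec) hP.choose_spec
      refine ⟨g, hg, fun h hh => ?_⟩
      rw [hgk]
      exact Nat.le_findGreatest (hbd _ ⟨h, hh, rfl⟩) ⟨h, hh, rfl⟩
    obtain ⟨g₀, hg₀, hmax₀⟩ := hex
    obtain ⟨g, hg, hgw, hle⟩ := hg₀.exists_fix hb hw
    have hmax := fun h hh => (hmax₀ h hh).trans hle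
    refine ⟨g, hg, hgw, fun u hu => ?_⟩
    by_contra hun
    have huX : u ∈ X.image g := by
      rw [mem_missed] at hun
      push Not at hun
      obtain ⟨m, hm, h⟩ := hun hu
      exact mem_image.2 ⟨m, hm, h⟩
    have hgu : g w ≠ u := by
      rintro rfl
      exact hA₀ w (hA.1 (hgw ▸ hu))
    -- An attained in-neighbour `u` makes the arc `(u, w)` superfluous: `g` avoids it and serves
    -- `w`, and for every other vertex `exists_avoid` gives a transversal with the same image that
    -- avoids it. This contradicts minimality.
    have : Q (A.erase (u, w)) := by
      have hstep : ∀ f, IsTransversal X b A f → f w ≠ u →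
          IsTransversal X b (A.erase (u, w)) f := by
        intro f hf hfw
        refine ⟨hf.1, fun m hm => (hf.2 m hm).imp_right fun h => mem_erase.2 ⟨?_, h⟩⟩
        intro h'
        obtain ⟨h1, h2⟩ := Prod.mk.inj h'
        exact hfw (h2 ▸ h1)
      refine ⟨(erase_subset _ _).trans hA.1, fun w' hw' f₀ hf₀ => ?_⟩
      obtain ⟨f, hf, hfle⟩ := hA.2 w' hw' f₀ hf₀
      by_cases hww : w' = w
      · subst hww
        refine ⟨g, hstep g hg hgu, (hfle.trans (hmax f hf)).trans (card_le_card ?_)⟩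
        intro n hn
        rw [mem_missed] at hn ⊢
        refine ⟨mem_erase.2 ⟨?_, hn.1⟩, hn.2⟩
        intro h
        obtain ⟨m, hm, hmu⟩ := mem_image.1 huX
        exact hn.2 m hm (hmu.trans (Prod.mk.inj h).1.symm)
      · obtain ⟨f', hf', hf'w, himg⟩ := hf.exists_avoid hg hw hgu huX hu hmax
        refine ⟨f', hstep f' hf' hf'w, hfle.trans (card_le_card ?_)⟩
        intro n hn
        rw [mem_missed] at hn ⊢
        refine ⟨mem_erase.2 ⟨fun h => hww (Prod.mk.inj h).2, hn.1⟩, fun m hm h => ?_⟩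
        have : n ∈ X.image f := himg ▸ mem_image.2 ⟨m, hm, h⟩
        obtain ⟨m', hm', h'⟩ := mem_image.1 this
        exact hn.2 m' hm' h'
    have h1 := hmin _ this
    have h2 := card_erase_lt_of_mem hu
    omega
  · intro f hf
    obtain ⟨f', -, hf'⟩ := hA.2 w hw f hf
    exact hf'.trans (card_le_card (filter_subset _ _))

end Transversal

/-! ### Alternating walks on half-vertices. -/

theorem units_eq_of_ne_neg {s t : ℤˣ} (h : s ≠ -t) : s = t := by
  rcases Int.units_eq_one_or s with rfl | rfl <;> rcases Int.units_eq_one_or t with rfl | rfl <;>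
    simp_all

section EvenWalk

variable {I R : Type*}

/-- The half-vertices: every vertex of `I` is split into two, and the sources in `R` are not. -/
abbrev Half (I R : Type*) := (I × ℤˣ) ⊕ R

/-- Walks that leave `p`, enter vertices `i` through one half `(i, s)` and leave them through the
other half `(i, -s)`, and finally stand ready to leave `q`. The list records the vertices entered. -/
inductive EvenWalk (E : Set (Sym2 (Half I R))) : Half I R → List I → Half I R → Prop
  | nil (p : Half I R) : EvenWalk E p [] p
  | cons {p q : Half I R} {i : I} {s : ℤˣ} {L : List I} (h : s(p, .inl (i, s)) ∈ E)
      (w : EvenWalk E (.inl (i, -s)) L q) : EvenWalk E p (i :: L) q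

namespace EvenWalk

variable {E E' : Set (Sym2 (Half I R))} {p q x : Half I R} {L L₁ L₂ : List I}

theorem mono (hE : E ⊆ E') (w : EvenWalk E p L q) : EvenWalk E' p L q := by
  induction w with
  | nil p => exact .nil p
  | cons h _ ih => exact .cons (hE h) ih

theorem append (w₁ : EvenWalk E p L₁ q) (w₂ : EvenWalk E q L₂ x) :
    EvenWalk E p (L₁ ++ L₂) x := by
  induction w₁ with
  | nil p => exact w₂
  | cons h _ ih => exact .cons h (ih w₂)

theorem concat (w : EvenWalk E p L q) {i : I} {s : ℤˣ} (h : s(q, .inl (i, s)) ∈ E) :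
    EvenWalk E p (L ++ [i]) (.inl (i, -s)) :=
  w.append (.cons h (.nil _))

theorem split (w : EvenWalk E p (L₁ ++ L₂) q) : ∃ x, EvenWalk E p L₁ x ∧ EvenWalk E x L₂ q := by
  induction L₁ generalizing p with
  | nil => exact ⟨p, .nil p, w⟩
  | cons i L₁ ih =>
    cases w with
    | cons h w =>
      obtain ⟨x, h1, h2⟩ := ih w
      exact ⟨x, .cons h h1, h2⟩

theorem split_concat {i : I} (w : EvenWalk E p (L ++ [i]) q) :
    ∃ x s, EvenWalk E p L x ∧ s(x, .inl (i, s)) ∈ E ∧ q = .inl (i, -s) := by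
  obtain ⟨x, h1, h2⟩ := w.split
  cases h2 with
  | cons h w =>
    cases w with
    | nil => exact ⟨x, _, h1, h, rfl⟩

theorem eq_nil_or_concat (w : EvenWalk E p L q) :
    (L = [] ∧ p = q) ∨ ∃ L' x i s, L = L' ++ [i] ∧ EvenWalk E p L' x ∧
      s(x, .inl (i, s)) ∈ E ∧ q = .inl (i, -s) := by
  rcases L.eq_nil_or_concat with rfl | ⟨L', i, rfl⟩
  · cases w; exact .inl ⟨rfl, rfl⟩
  · rw [List.concat_eq_append] at *
    obtain ⟨x, s, h⟩ := w.split_concat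
    exact .inr ⟨L', x, i, s, rfl, h⟩

theorem eq_nil_of_source {ρ : R} (w : EvenWalk E p L (.inr ρ)) : L = [] ∧ p = .inr ρ := by
  rcases w.eq_nil_or_concat with h | ⟨_, _, _, _, _, _, _, h⟩
  · exact h
  · cases h

theorem mem_of_ne {i : I} {s : ℤˣ} (w : EvenWalk E p L (.inl (i, s))) (h : p ≠ .inl (i, s)) :
    i ∈ L := by
  rcases w.eq_nil_or_concat with ⟨_, h'⟩ | ⟨L', _, j, _, rfl, _, _, h'⟩
  · exact absurd h' h
  · obtain ⟨rfl, -⟩ := Prod.mk.inj (Sum.inl.inj h')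
    simp

/-- A walk stops before its final edge. The edge `s(x, q)` lets the reversed walk enter its first
vertex, and the edge by which the original walk leaves `p` is the one left over. -/
theorem reverse (w : EvenWalk E p L q) (h : s(x, q) ∈ E) :
    ∃ y, EvenWalk E x L.reverse y ∧ s(y, p) ∈ E := by
  induction w with
  | nil p => exact ⟨x, .nil x, h⟩
  | cons h' _ ih =>
    obtain ⟨y, h1, h2⟩ := ih h
    refine ⟨_, List.reverse_cons ▸ h1.concat h2, ?_⟩
    rw [neg_neg, Sym2.eq_swap]
    exact h'

open Classical in
theorem exists_finset (w : EvenWalk E p L q) :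
    ∃ F : Finset (Sym2 (Half I R)), (F : Set _) ⊆ E ∧ F.card ≤ L.length ∧ EvenWalk F p L q := by
  induction w with
  | nil p => exact ⟨∅, by simp, by simp, .nil p⟩
  | @cons p q i s L h _ ih =>
    obtain ⟨F, h1, h2, h3⟩ := ih
    refine ⟨insert s(p, .inl (i, s)) F, ?_, ?_, ?_⟩
    · rw [Finset.coe_insert]; exact Set.insert_subset h h1
    · exact (Finset.card_insert_le _ _).trans (by simpa using h2)
    · exact .cons (by simp) (h3.mono (by simp))

/-- Every vertex on an ear can be left through both of its halves, entering the ear at one of its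
two ends. -/
theorem ear (w : EvenWalk E q L x) (h : s(p, x) ∈ E) {i : I} (hi : i ∈ L) (s : ℤˣ) :
    ∃ L', L'.Sublist L ∧ (EvenWalk E q L' (.inl (i, s)) ∨
      EvenWalk E p L'.reverse (.inl (i, s))) := by
  obtain ⟨L₁, L₂, rfl⟩ := List.append_of_mem hi
  rw [List.append_cons] at w
  obtain ⟨y, w₁, w₂⟩ := w.split
  obtain ⟨z, t, -, -, rfl⟩ := w₁.split_concat
  by_cases hs : s = -t
  · subst hs
    exact ⟨L₁ ++ [i], by rw [List.append_cons L₁ i L₂]; exact List.sublist_append_left _ _, .inl w₁⟩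
  · obtain rfl := units_eq_of_ne_neg hs
    obtain ⟨y, h1, h2⟩ := w₂.reverse h
    refine ⟨i :: L₂, List.sublist_append_right _ _, .inr ?_⟩
    have := h1.concat h2
    rwa [neg_neg, ← List.reverse_cons] at this

/-- The first vertex of a walk outside of a given set. -/
theorem exists_first {Z : Set I} (w : EvenWalk E p L q) (h : ∃ i ∈ L, i ∉ Z) :
    ∃ L₁ i L₂ s y, L = L₁ ++ i :: L₂ ∧ (∀ j ∈ L₁, j ∈ Z) ∧ i ∉ Z ∧ EvenWalk E p L₁ y ∧
      s(y, .inl (i, s)) ∈ E := by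
  induction w with
  | nil p => simp at h
  | @cons p q i s L h' w ih =>
    by_cases hi : i ∈ Z
    · have : ∃ i ∈ L, i ∉ Z := by
        obtain ⟨j, hj, hjZ⟩ := h
        rcases List.mem_cons.1 hj with rfl | hj
        · exact absurd hi hjZ
        · exact ⟨j, hj, hjZ⟩
      obtain ⟨L₁, j, L₂, t, y, rfl, h1, h2, h3, h4⟩ := ih this
      refine ⟨i :: L₁, j, L₂, t, y, rfl, ?_, h2, .cons h' h3, h4⟩
      simpa [hi] using h1
    · exact ⟨[], i, L, s, p, rfl, by simp, hi, .nil p, h'⟩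

/-- The part of a walk after its last vertex in a given set. -/
theorem exists_last {Z : Set I} (w : EvenWalk E p L q) :
    ∃ L₁ L₂ y, L = L₁ ++ L₂ ∧ (∀ j ∈ L₂, j ∉ Z) ∧ EvenWalk E p L₁ y ∧ EvenWalk E y L₂ q ∧
      (y = p ∨ ∃ i ∈ Z, ∃ s, y = .inl (i, s)) := by
  induction L using List.reverseRecOn generalizing q with
  | nil => cases w; exact ⟨[], [], p, rfl, by simp, .nil p, .nil p, .inl rfl⟩
  | append_singleton L i ih =>
    obtain ⟨x, s, w', h, rfl⟩ := w.split_concat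
    by_cases hi : i ∈ Z
    · exact ⟨L ++ [i], [], _, by simp, by simp, w, .nil _, .inr ⟨i, hi, _, rfl⟩⟩
    · obtain ⟨L₁, L₂, y, rfl, h1, h2, h3, h4⟩ := ih w'
      refine ⟨L₁, L₂ ++ [i], y, by simp, ?_, h2, h3.concat h, h4⟩
      intro j hj
      rcases List.mem_append.1 hj with hj | hj
      · exact h1 j hj
      · rwa [List.mem_singleton.1 hj]

end EvenWalk

/-! ### Blossoms, bases and partial explorations. -/

/-- The half-vertex `p` can be left by a walk from a source that does not repeat vertices. -/
def EvenReach (E : Set (Sym2 (Half I R))) (p : Half I R) : Prop :=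
  ∃ ρ L, EvenWalk E (.inr ρ) L p ∧ L.Nodup

/-- Both halves of `i` can be left. -/
def IsBlossom (E : Set (Sym2 (Half I R))) (i : I) : Prop :=
  ∀ s, EvenReach E (.inl (i, s))

/-- A half-vertex that can be left and is a source or the half of a vertex whose other half cannot
be left. -/
def IsBase (E : Set (Sym2 (Half I R))) (p : Half I R) : Prop :=
  EvenReach E p ∧ ∀ i s, p = .inl (i, s) → ¬ EvenReach E (.inl (i, -s))

/-- There is no walk between different sources that does not repeat vertices. -/
def NoAugmenting (E : Set (Sym2 (Half I R))) : Prop :=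
  ∀ ρ ρ' L y, EvenWalk E (.inr ρ) L y → L.Nodup → s(y, .inr ρ') ∈ E → ρ = ρ'

/-- The extension of a function on vertices to half-vertices, by the identity on sources. -/
def baseOf (b : I → Half I R) : Half I R → Half I R := Sum.elim (fun x => b x.1) Sum.inr

@[simp] theorem baseOf_inl (b : I → Half I R) (i : I) (s : ℤˣ) : baseOf b (.inl (i, s)) = b i := rfl

/-- The half-vertex `p` is a source or belongs to a vertex in `Z`. -/
def HalfMem (Z : Finset I) (p : Half I R) : Prop := ∀ i s, p = .inl (i, s) → i ∈ Z

theorem halfMem_inr (Z : Finset I) (ρ : R) : HalfMem Z (.inr ρ : Half I R) :=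
  fun _ _ h => by cases h

theorem halfMem_inl {Z : Finset I} {i : I} {s : ℤˣ} :
    HalfMem Z (.inl (i, s) : Half I R) ↔ i ∈ Z :=
  ⟨fun h => h i s rfl, fun h j t e => by cases e; exact h⟩

theorem evenReach_inr (E : Set (Sym2 (Half I R))) (ρ : R) : EvenReach E (.inr ρ) :=
  ⟨ρ, [], .nil _, List.nodup_nil⟩

theorem isBase_inr (E : Set (Sym2 (Half I R))) (ρ : R) : IsBase E (.inr ρ) :=
  ⟨evenReach_inr E ρ, fun _ _ h => by cases h⟩

theorem IsBase.not_isBlossom {E : Set (Sym2 (Half I R))} {i : I} {s : ℤˣ}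
    (h : IsBase E (.inl (i, s))) : ¬ IsBlossom E i :=
  fun h' => h.2 i s rfl (h' _)

/-- The moment at which a base is added. -/
def stage (time : I → ℕ) : Half I R → ℕ := Sum.elim (fun x => time x.1 + 1) (fun _ => 0)

open Classical in
/-- A partially explored blossom structure: `Z` is the set of explored vertices, `b` assigns to
every explored vertex the base of its blossom, and `F` consists of edges inside the blossoms. -/
structure Exploration (E : Set (Sym2 (Half I R))) (Z : Finset I) (b : I → Half I R)
    (time : I → ℕ) (F : Finset (Sym2 (Half I R))) : Prop where
  isBase : ∀ i ∈ Z, IsBase E (b i)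
  base_mem : ∀ i ∈ Z, HalfMem Z (b i)
  inner : ∀ i ∈ Z, ∀ s, EvenReach E (.inl (i, s)) →
    ∃ L, EvenWalk (F : Set _) (b i) L (.inl (i, s)) ∧ L.Nodup ∧
      ∀ x ∈ L, x ∈ Z ∧ IsBlossom E x ∧ b x = b i
  access : ∀ n, IsBase E n → HalfMem Z n →
    ∃ ρ L, EvenWalk E (.inr ρ) L n ∧ L.Nodup ∧
      ∀ x ∈ L, x ∈ Z ∧ (b x = n ∧ ¬ IsBlossom E x ∨ stage time (b x) < stage time n)
  subset : (F : Set _) ⊆ E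
  card_le : F.card ≤ 2 * (Z.filter (IsBlossom E)).card

namespace Exploration

variable {E : Set (Sym2 (Half I R))} {Z : Finset I} {b : I → Half I R} {time : I → ℕ}
  {F : Finset (Sym2 (Half I R))}

theorem isBase_baseOf (h : Exploration E Z b time F) {p : Half I R} (hp : HalfMem Z p) :
    IsBase E (baseOf b p) ∧ HalfMem Z (baseOf b p) := by
  rcases p with ⟨i, s⟩ | ρ
  · exact ⟨h.isBase i (halfMem_inl.1 hp), h.base_mem i (halfMem_inl.1 hp)⟩
  · exact ⟨isBase_inr E ρ, halfMem_inr Z ρ⟩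

theorem exists_inner (h : Exploration E Z b time F) {p : Half I R} (hp : HalfMem Z p)
    (he : EvenReach E p) :
    ∃ L, EvenWalk (F : Set _) (baseOf b p) L p ∧ L.Nodup ∧
      ∀ x ∈ L, x ∈ Z ∧ IsBlossom E x ∧ b x = baseOf b p := by
  rcases p with ⟨i, s⟩ | ρ
  · exact h.inner i (halfMem_inl.1 hp) s he
  · exact ⟨[], .nil _, List.nodup_nil, by simp⟩

/-- If the base of `i` were different, the inner walk to `(i, s)` would pass through `i` and make it
a blossom vertex. -/
theorem base_eq (h : Exploration E Z b time F) {i : I} {s : ℤˣ} (hi : i ∈ Z)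
    (hb : IsBase E (.inl (i, s))) : b i = .inl (i, s) := by
  obtain ⟨L, hw, -, hL⟩ := h.inner i hi s hb.1
  by_contra hne
  exact hb.not_isBlossom (hL i (hw.mem_of_ne hne)).2.1

/-- A walk through the explored part to an explored half-vertex. -/
theorem exists_walk (h : Exploration E Z b time F) {p : Half I R} (hp : HalfMem Z p)
    (he : EvenReach E p) :
    ∃ ρ L, EvenWalk E (.inr ρ) L p ∧ L.Nodup ∧
      (∀ x ∈ L, x ∈ Z ∧ (b x = baseOf b p ∨ stage time (b x) < stage time (baseOf b p))) ∧
      (∀ ρ', baseOf b p = .inr ρ' → ρ' = ρ) := by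
  obtain ⟨hb, hbZ⟩ := h.isBase_baseOf hp
  obtain ⟨ρ, L₀, w₀, hn₀, hL₀⟩ := h.access _ hb hbZ
  obtain ⟨L₁, w₁, hn₁, hL₁⟩ := h.exists_inner hp he
  -- The walk to the base meets vertices with this base only outside blossoms, the inner walk only
  -- uses blossom vertices; hence nothing is repeated.
  refine ⟨ρ, L₀ ++ L₁, w₀.append (w₁.mono h.subset), ?_, ?_, ?_⟩
  · refine hn₀.append hn₁ fun x h0 h1 => ?_
    rcases (hL₀ x h0).2 with h2 | h2
    · exact h2.2 (hL₁ x h1).2.1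
    · rw [(hL₁ x h1).2.2] at h2; exact lt_irrefl _ h2
  · intro x hx
    rcases List.mem_append.1 hx with hx | hx
    · exact ⟨(hL₀ x hx).1, (hL₀ x hx).2.imp And.left id⟩
    · exact ⟨(hL₁ x hx).1, .inl (hL₁ x hx).2.2⟩
  · intro ρ' hρ
    rw [hρ] at w₀
    exact (Sum.inr.inj w₀.eq_nil_of_source.2).symm

/-- If the bases differ, the explored walk to `p` avoids all vertices with the base of `q`, because
stages never exceed that of the base of `p` along it. It can then be continued by `w` and backwards
through the blossom of `q` to its base. This arrives at the base by its forbidden half, or at a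
source, where the absence of augmenting walks forces both bases to be that source. -/
theorem base_eq_of_stage_le (hE : NoAugmenting E) (h : Exploration E Z b time F)
    {p q y : Half I R} (hp : HalfMem Z p) (hq : HalfMem Z q) (hep : EvenReach E p)
    (heq : EvenReach E q) {L : List I} (w : EvenWalk E p L y) (hL : L.Nodup)
    (hLZ : ∀ x ∈ L, x ∉ Z) (hyq : s(y, q) ∈ E)
    (hst : stage time (baseOf b p) ≤ stage time (baseOf b q)) : baseOf b p = baseOf b q := by
  by_contra hne
  obtain ⟨ρ, L₀, w₀, hn₀, hL₀, hρ⟩ := h.exists_walk hp hep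
  obtain ⟨L₂, w₂, hn₂, hL₂⟩ := h.exists_inner hq heq
  obtain ⟨y', w₃, hy'⟩ := (w₂.mono h.subset).reverse hyq
  have w₄ := (w₀.append w).append w₃
  have hav : ∀ x ∈ L₀, b x ≠ baseOf b q := by
    intro x hx hx'
    rcases (hL₀ x hx).2 with h1 | h1
    · exact hne (h1.symm.trans hx')
    · rw [hx'] at h1; omega
  have hnd : ((L₀ ++ L) ++ L₂.reverse).Nodup := by
    refine (hn₀.append hL fun x h1 h2 => hLZ x h2 (hL₀ x h1).1).append
      (List.nodup_reverse.2 hn₂) fun x h1 h2 => ?_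
    have h3 := hL₂ x (List.mem_reverse.1 h2)
    rcases List.mem_append.1 h1 with h1 | h1
    · exact hav x h1 h3.2.2
    · exact hLZ x h1 h3.1
  obtain ⟨hb, hbZ⟩ := h.isBase_baseOf hq
  rcases hbq : baseOf b q with ⟨m, t⟩ | ρ'
  · rw [hbq] at hb hbZ hy'
    refine hb.2 m t rfl ⟨ρ, _, w₄.concat hy', hnd.append (List.nodup_singleton m) ?_⟩
    intro x hx hxm
    rw [List.mem_singleton] at hxm
    subst hxm
    have hbx := h.base_eq (halfMem_inl.1 hbZ) hb
    simp only [List.mem_append, List.mem_reverse] at hx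
    rcases hx with (hx | hx) | hx
    · exact hav x hx (hbx.trans hbq.symm)
    · exact hLZ x hx (halfMem_inl.1 hbZ)
    · exact hb.not_isBlossom (hL₂ x hx).2.1
  · rw [hbq] at hy' hst hne
    have := hE _ _ _ _ w₄ hnd hy'
    subst this
    rcases hbp : baseOf b p with ⟨m, t⟩ | ρ'
    · rw [hbp] at hst
      simp [stage] at hst
    · exact hne (hbp.trans (by rw [hρ ρ' hbp]))

/-- Explored half-vertices that are joined outside of the explored part have the same base. -/
theorem base_eq_of_walk (hE : NoAugmenting E) (h : Exploration E Z b time F)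
    {p q y : Half I R} (hp : HalfMem Z p) (hq : HalfMem Z q) (hep : EvenReach E p)
    (heq : EvenReach E q) {L : List I} (w : EvenWalk E p L y) (hL : L.Nodup)
    (hLZ : ∀ x ∈ L, x ∉ Z) (hyq : s(y, q) ∈ E) : baseOf b p = baseOf b q := by
  rcases le_total (stage time (baseOf b p)) (stage time (baseOf b q)) with hst | hst
  · exact base_eq_of_stage_le hE h hp hq hep heq w hL hLZ hyq hst
  · rw [Sym2.eq_swap] at hyq
    obtain ⟨y', w', hy'⟩ := w.reverse hyq
    exact (base_eq_of_stage_le hE h hq hp heq hep w' (List.nodup_reverse.2 hL)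
      (fun x hx => hLZ x (List.mem_reverse.1 hx)) hy' hst).symm

end Exploration

end EvenWalk

/-! ### Growing an exploration by bases and ears. -/

section EvenWalk

variable {I R : Type*}

namespace Exploration

variable {E : Set (Sym2 (Half I R))} {Z : Finset I} {b : I → Half I R} {time : I → ℕ}
  {F : Finset (Sym2 (Half I R))}

open Classical in
theorem stage_update {p : Half I R} (hp : HalfMem Z p) {x : I} (hx : x ∉ Z) (c : ℕ) :
    stage (Function.update time x c) p = stage time p := by
  rcases p with ⟨i, s⟩ | ρ
  · have : i ≠ x := fun h => hx (h ▸ halfMem_inl.1 hp)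
    simp [stage, this]
  · rfl

theorem evenReach_of_adj (h : Exploration E Z b time F) {p : Half I R} (hp : HalfMem Z p)
    (hep : EvenReach E p) {x : I} {s : ℤˣ} (hx : x ∉ Z) (hpx : s(p, .inl (x, s)) ∈ E) :
    EvenReach E (.inl (x, -s)) := by
  obtain ⟨ρ, L, w, hn, hL, -⟩ := h.exists_walk hp hep
  refine ⟨ρ, _, w.concat hpx, hn.append (List.nodup_singleton x) fun y hy hyx => ?_⟩
  exact hx (List.mem_singleton.1 hyx ▸ (hL y hy).1)

-- A new vertex that cannot be left through the half by which it is entered is its own base, and no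
-- edge has to be added.
open Classical in
theorem extend_base (h : Exploration E Z b time F) {p : Half I R} (hp : HalfMem Z p)
    (hep : EvenReach E p) {x : I} {s : ℤˣ} (hx : x ∉ Z) (hpx : s(p, .inl (x, s)) ∈ E)
    (hxs : ¬ EvenReach E (.inl (x, s))) :
    ∃ b' time', Exploration E (insert x Z) b' time' F := by
  have hex := h.evenReach_of_adj hp hep hx hpx
  have hbx : IsBase E (.inl (x, -s)) := ⟨hex, by
    rintro i t ⟨⟩; rwa [neg_neg]⟩
  have hne : ∀ i ∈ Z, i ≠ x := fun i hi h => hx (h ▸ hi)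
  let b' := Function.update b x (.inl (x, -s))
  -- With this time the stage of the new base is one more than all stages occurring so far.
  let time' := Function.update time x (Z.sup fun i => stage time (b i))
  have hb' : ∀ i ∈ Z, b' i = b i := fun i hi => Function.update_of_ne (hne i hi) _ _
  have hb'x : b' x = .inl (x, -s) := Function.update_self _ _ _
  have hmem : ∀ {n : Half I R}, HalfMem Z n → HalfMem (insert x Z) n :=
    fun hn i s e => Finset.mem_insert_of_mem (hn i s e)
  refine ⟨b', time', ⟨?_, ?_, ?_, ?_, h.subset, ?_⟩⟩
  · intro i hi
    rcases Finset.mem_insert.1 hi with rfl | hi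
    · rw [hb'x]; exact hbx
    · rw [hb' i hi]; exact h.isBase i hi
  · intro i hi
    rcases Finset.mem_insert.1 hi with rfl | hi
    · rw [hb'x]; exact halfMem_inl.2 (Finset.mem_insert_self _ _)
    · rw [hb' i hi]; exact hmem (h.base_mem i hi)
  · intro i hi t hit
    rcases Finset.mem_insert.1 hi with rfl | hi
    · have : t = -s := by
        by_contra hts
        exact hxs (units_eq_of_ne_neg hts ▸ hit)
      subst this
      exact ⟨[], by rw [hb'x]; exact .nil _, List.nodup_nil, by simp⟩
    · obtain ⟨L, w, hn, hL⟩ := h.inner i hi t hit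
      refine ⟨L, by rw [hb' i hi]; exact w, hn, fun y hy => ?_⟩
      obtain ⟨h1, h2, h3⟩ := hL y hy
      exact ⟨Finset.mem_insert_of_mem h1, h2, by rw [hb' y h1, hb' i hi, h3]⟩
  · intro n hn hnZ
    by_cases hnx : HalfMem Z n
    · obtain ⟨ρ, L, w, hnd, hL⟩ := h.access n hn hnx
      refine ⟨ρ, L, w, hnd, fun y hy => ?_⟩
      obtain ⟨h1, h2⟩ := hL y hy
      refine ⟨Finset.mem_insert_of_mem h1, ?_⟩
      rw [hb' y h1, stage_update (h.base_mem y h1) hx, stage_update hnx hx]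
      exact h2
    · have hnx' : n = .inl (x, -s) := by
        rcases n with ⟨i, t⟩ | ρ
        · have hix : i = x := by
            by_contra hix
            exact hnx (halfMem_inl.2 (Finset.mem_of_mem_insert_of_ne (halfMem_inl.1 hnZ) hix))
          subst hix
          by_contra hts
          have hts' : t ≠ -s := fun e => hts (by rw [e])
          exact hxs (units_eq_of_ne_neg hts' ▸ hn.1)
        · exact absurd (halfMem_inr Z ρ) hnx
      subst hnx'
      obtain ⟨ρ, L, w, hnd, hL, -⟩ := h.exists_walk hp hep
      refine ⟨ρ, _, w.concat hpx, hnd.append (List.nodup_singleton x) ?_, fun y hy => ?_⟩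
      · exact fun y hy hyx => hx (List.mem_singleton.1 hyx ▸ (hL y hy).1)
      · rcases List.mem_append.1 hy with hy | hy
        · have hyZ := (hL y hy).1
          refine ⟨Finset.mem_insert_of_mem hyZ, .inr ?_⟩
          rw [hb' y hyZ, stage_update (h.base_mem y hyZ) hx]
          have : stage time (b y) ≤ Z.sup fun i => stage time (b i) :=
            Finset.le_sup (f := fun i => stage time (b i)) hyZ
          simpa [stage, time', Nat.lt_succ_iff] using this
        · rw [List.mem_singleton] at hy
          subst hy
          exact ⟨Finset.mem_insert_self _ _, .inl ⟨hb'x, hbx.not_isBlossom⟩⟩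
  · exact h.card_le.trans (Nat.mul_le_mul_left 2 (Finset.card_le_card
      (Finset.filter_subset_filter _ (Finset.subset_insert _ _))))

-- Both ends of the ear have the same base by `base_eq_of_walk`. Entering the ear from either end
-- makes both halves of its vertices leavable, so they all join the blossom of that base. No new
-- base arises, so `time` is unchanged, and nonemptiness of the ear gives `ℓ + 1 ≤ 2ℓ` for its
-- edges.
open Classical in
theorem extend_ear (hE : NoAugmenting E) (h : Exploration E Z b time F) {p q z : Half I R}
    (hp : HalfMem Z p) (hep : EvenReach E p) (hq : HalfMem Z q) (heq : EvenReach E q)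
    {L : List I} (w : EvenWalk E q L z) (hpz : s(p, z) ∈ E) (hL : L.Nodup)
    (hLZ : ∀ x ∈ L, x ∉ Z) (hL0 : L ≠ []) :
    ∃ b' F', Exploration E (Z ∪ L.toFinset) b' time F' := by
  have hbase : baseOf b p = baseOf b q := by
    obtain ⟨y, w', hy⟩ := w.reverse hpz
    exact h.base_eq_of_walk hE hp hq hep heq w' (List.nodup_reverse.2 hL)
      (fun x hx => hLZ x (List.mem_reverse.1 hx)) hy
  obtain ⟨F₁, hF₁, hcard, w₁⟩ := w.exists_finset
  let F' := F ∪ insert s(p, z) F₁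
  have hF'E : (F' : Set _) ⊆ E := by
    simp only [F', Finset.coe_union, Finset.coe_insert]
    exact Set.union_subset h.subset (Set.insert_subset hpz hF₁)
  have hFF' : (F : Set (Sym2 (Half I R))) ⊆ (F' : Set (Sym2 (Half I R))) :=
    Finset.coe_subset.2 Finset.subset_union_left
  have hear : ∀ i ∈ L, ∀ s, ∃ x, (x = p ∨ x = q) ∧ ∃ L', EvenWalk (F' : Set _) x L' (.inl (i, s)) ∧
      L'.Nodup ∧ ∀ j ∈ L', j ∈ L := by
    intro i hi s
    have w₂ : EvenWalk (F' : Set _) q L z := w₁.mono (by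
      intro e he; simp only [F', Finset.coe_union, Finset.coe_insert]; exact .inr (.inr he))
    obtain ⟨L', hL', hw⟩ := w₂.ear (p := p) (by simp [F']) hi s
    rcases hw with hw | hw
    · exact ⟨q, .inr rfl, L', hw, hL'.nodup hL, fun j hj => hL'.subset hj⟩
    · exact ⟨p, .inl rfl, _, hw, List.nodup_reverse.2 (hL'.nodup hL),
        fun j hj => hL'.subset (List.mem_reverse.1 hj)⟩
  have hbl : ∀ i ∈ L, IsBlossom E i := by
    intro i hi s
    obtain ⟨x, hx, L', hw, hn, hL'⟩ := hear i hi s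
    have hxx : HalfMem Z x ∧ EvenReach E x := by
      rcases hx with rfl | rfl
      · exact ⟨hp, hep⟩
      · exact ⟨hq, heq⟩
    obtain ⟨ρ, L₀, w₀, hn₀, hL₀, -⟩ := h.exists_walk hxx.1 hxx.2
    exact ⟨ρ, _, w₀.append (hw.mono hF'E),
      hn₀.append hn fun j h1 h2 => hLZ j (hL' j h2) (hL₀ j h1).1⟩
  let b' : I → Half I R := fun i => if i ∈ L then baseOf b q else b i
  have hb' : ∀ i ∈ Z, b' i = b i := fun i hi => if_neg fun hiL => hLZ i hiL hi
  have hb'L : ∀ i ∈ L, b' i = baseOf b q := fun i hi => if_pos hi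
  have hmem : ∀ {n : Half I R}, HalfMem Z n → HalfMem (Z ∪ L.toFinset) n :=
    fun hn i s e => Finset.mem_union_left _ (hn i s e)
  have hcases : ∀ {i}, i ∈ Z ∪ L.toFinset → i ∈ Z ∨ i ∈ L := by simp
  obtain ⟨hbq, hbqZ⟩ := h.isBase_baseOf hq
  refine ⟨b', F', ⟨?_, ?_, ?_, ?_, hF'E, ?_⟩⟩
  · intro i hi
    rcases hcases hi with hi | hi
    · rw [hb' i hi]; exact h.isBase i hi
    · rw [hb'L i hi]; exact hbq
  · intro i hi
    rcases hcases hi with hi | hi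
    · rw [hb' i hi]; exact hmem (h.base_mem i hi)
    · rw [hb'L i hi]; exact hmem hbqZ
  · intro i hi t hit
    rcases hcases hi with hi | hi
    · obtain ⟨L', w', hn, hL'⟩ := h.inner i hi t hit
      refine ⟨L', by rw [hb' i hi]; exact w'.mono hFF', hn, fun y hy => ?_⟩
      obtain ⟨h1, h2, h3⟩ := hL' y hy
      exact ⟨Finset.mem_union_left _ h1, h2, by rw [hb' y h1, hb' i hi, h3]⟩
    · obtain ⟨x, hx, L', hw, hn, hL'⟩ := hear i hi t
      have hxx : HalfMem Z x ∧ EvenReach E x ∧ baseOf b x = baseOf b q := by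
        rcases hx with rfl | rfl
        · exact ⟨hp, hep, hbase⟩
        · exact ⟨hq, heq, rfl⟩
      obtain ⟨L₀, w₀, hn₀, hL₀⟩ := h.exists_inner hxx.1 hxx.2.1
      rw [hxx.2.2] at w₀ hL₀
      refine ⟨L₀ ++ L', ?_, hn₀.append hn fun j h1 h2 => hLZ j (hL' j h2) (hL₀ j h1).1, ?_⟩
      · rw [hb'L i hi]; exact (w₀.mono hFF').append hw
      · intro y hy
        rw [hb'L i hi]
        rcases List.mem_append.1 hy with hy | hy
        · obtain ⟨h1, h2, h3⟩ := hL₀ y hy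
          exact ⟨Finset.mem_union_left _ h1, h2, by rw [hb' y h1, h3]⟩
        · have := hL' y hy
          exact ⟨by simp [this], hbl y this, hb'L y this⟩
  · intro n hn hnZ
    have hnZ' : HalfMem Z n := by
      rintro i s rfl
      refine (hcases (halfMem_inl.1 hnZ)).resolve_right fun hi => ?_
      exact hn.not_isBlossom (hbl i hi)
    obtain ⟨ρ, L', w', hnd, hL'⟩ := h.access n hn hnZ'
    refine ⟨ρ, L', w', hnd, fun y hy => ?_⟩
    obtain ⟨h1, h2⟩ := hL' y hy
    exact ⟨Finset.mem_union_left _ h1, by rw [hb' y h1]; exact h2⟩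
  · have h1 : ((Z ∪ L.toFinset).filter (IsBlossom E)).card =
        (Z.filter (IsBlossom E)).card + L.length := by
      rw [Finset.filter_union, Finset.card_union_of_disjoint, Finset.filter_true_of_mem
        (s := L.toFinset), List.toFinset_card_of_nodup hL]
      · intro i hi; exact hbl i (List.mem_toFinset.1 hi)
      · rw [Finset.disjoint_left]
        intro i hi hi'
        exact hLZ i (List.mem_toFinset.1 (Finset.mem_filter.1 hi').1) (Finset.mem_filter.1 hi).1
    have h2 : F'.card ≤ F.card + (F₁.card + 1) :=
      (Finset.card_union_le _ _).trans (Nat.add_le_add_left (Finset.card_insert_le _ _) _)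
    have h3 := h.card_le
    have h4 : 0 < L.length := List.length_pos_of_ne_nil hL0
    rw [h1]
    omega

/-- Let `x` be the first unexplored vertex on a walk to `i`, entered through `(x, t)`. If `(x, t)`
cannot be left, `x` is a new base. Otherwise the part after the last explored vertex of a walk ready
to leave `(x, t)`, closed by the edge into `(x, t)`, is an ear. -/
theorem exists_larger (hE : NoAugmenting E) (h : Exploration E Z b time F) {i : I} {s : ℤˣ}
    (hi : i ∉ Z) (his : EvenReach E (.inl (i, s))) :
    ∃ Z' b' time' F', Exploration E Z' b' time' F' ∧ Z.card < Z'.card := by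
  classical
  obtain ⟨ρ, L, w, hn⟩ := his
  obtain ⟨L₁, x, L₂, t, p, rfl, hL₁, hx, w₁, hpx⟩ := w.exists_first (Z := (Z : Set I))
    ⟨i, w.mem_of_ne (by simp), hi⟩
  have hep : EvenReach E p := ⟨ρ, L₁, w₁, hn.of_append_left⟩
  have hp : HalfMem Z p := by
    rintro j u rfl
    exact hL₁ j (w₁.mem_of_ne (by simp))
  by_cases hxt : EvenReach E (.inl (x, t))
  · obtain ⟨ρ', L', w', hn'⟩ := hxt
    obtain ⟨La, Lb, q, rfl, hLb, wa, wb, hq⟩ := w'.exists_last (Z := (Z : Set I))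
    have heq : EvenReach E q := ⟨ρ', La, wa, hn'.of_append_left⟩
    have hqZ : HalfMem Z q := by
      rcases hq with rfl | ⟨j, hj, u, rfl⟩
      · exact halfMem_inr _ _
      · exact halfMem_inl.2 hj
    have hxq : q ≠ .inl (x, t) := by
      rintro rfl
      exact hx (halfMem_inl.1 hqZ)
    have hxL : x ∈ Lb := wb.mem_of_ne hxq
    obtain ⟨b', F', h'⟩ := h.extend_ear hE hp hep hqZ heq wb hpx hn'.of_append_right hLb
      (List.ne_nil_of_mem hxL)
    refine ⟨_, b', time, F', h', Finset.card_lt_card ?_⟩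
    refine Finset.ssubset_iff_subset_ne.2 ⟨Finset.subset_union_left, fun he => hx ?_⟩
    rw [Finset.mem_coe, he]
    simp [hxL]
  · obtain ⟨b', time', h'⟩ := h.extend_base hp hep hx hpx hxt
    exact ⟨_, b', time', F, h', Finset.card_lt_card (Finset.ssubset_insert hx)⟩

end Exploration

/-- The blossom structure: a base for every vertex that can be reached, constant along the edges
between halves that can be left, together with edges that suffice to move inside blossoms. -/
structure BlossomStructure (E : Set (Sym2 (Half I R))) (b : I → Half I R)
    (F : Set (Sym2 (Half I R))) : Prop where
  subset : F ⊆ E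
  isBase : ∀ i s, EvenReach E (.inl (i, s)) → IsBase E (b i)
  base_eq : ∀ i s, IsBase E (.inl (i, s)) → b i = .inl (i, s)
  inner : ∀ p, EvenReach E p → ∃ L, EvenWalk F (baseOf b p) L p ∧ L.Nodup ∧
    ∀ x ∈ L, IsBlossom E x ∧ b x = baseOf b p
  adj : ∀ p q, EvenReach E p → EvenReach E q → s(p, q) ∈ E → baseOf b p = baseOf b q

-- A largest exploration contains every vertex that can be left, since any other one could be
-- enlarged.
open Classical in
theorem exists_blossomStructure [Fintype I] {E : Set (Sym2 (Half I R))} (hE : NoAugmenting E) :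
    ∃ (b : I → Half I R) (F : Finset (Sym2 (Half I R))), BlossomStructure E b F ∧
      F.card ≤ 2 * (Finset.univ.filter (IsBlossom E)).card := by
  let P : ℕ → Prop := fun k => ∃ Z b time F, Exploration E Z b time F ∧ Z.card = k
  have hP0 : P 0 := by
    refine ⟨∅, fun i => .inl (i, 1), fun _ => 0, ∅, ⟨by simp, by simp, by simp, ?_, by simp,
      by simp⟩, rfl⟩
    rintro (⟨i, s⟩ | ρ) hn hZ
    · simpa using halfMem_inl.1 hZ
    · exact ⟨ρ, [], .nil _, List.nodup_nil, by simp⟩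
  have hbd : ∀ k, P k → k ≤ Fintype.card I := by
    rintro k ⟨Z, -, -, -, -, rfl⟩; exact Finset.card_le_univ Z
  obtain ⟨Z, b, time, F, h, hZ⟩ := Nat.findGreatest_spec (Nat.zero_le (Fintype.card I)) hP0
  have hall : ∀ i s, EvenReach E (.inl (i, s)) → i ∈ Z := by
    intro i s his
    by_contra hi
    obtain ⟨Z', b', time', F', h', hlt⟩ := h.exists_larger hE hi his
    have hP' : P Z'.card := ⟨Z', b', time', F', h', rfl⟩
    have := Nat.le_findGreatest (hbd _ hP') hP'
    omega
  have hmem : ∀ p, EvenReach E p → HalfMem Z p := by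
    rintro p hp i s rfl; exact hall i s hp
  refine ⟨b, F, ⟨h.subset, ?_, ?_, ?_, ?_⟩, h.card_le.trans (Nat.mul_le_mul_left 2
    (Finset.card_le_card (Finset.filter_subset_filter _ (Finset.subset_univ Z))))⟩
  · exact fun i s his => h.isBase i (hall i s his)
  · exact fun i s his => h.base_eq (hall i s his.1) his
  · intro p hp
    obtain ⟨L, w, hn, hL⟩ := h.exists_inner (hmem p hp) hp
    exact ⟨L, w, hn, fun x hx => (hL x hx).2⟩
  · intro p q hp hq hpq
    exact h.base_eq_of_walk hE (hmem p hp) (hmem q hq) hp hq (.nil p) List.nodup_nil (by simp) hpq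

end EvenWalk

/-! ### Linkages, and their contraction to transversals on the spine. -/

section EvenWalk

variable {I R : Type*}

/-- There are `k` walks from different sources that enter `i` through `(i, s)`, do not repeat
vertices, and are disjoint except for `i`. -/
def HasLinkage (E : Set (Sym2 (Half I R))) (i : I) (s : ℤˣ) (k : ℕ) : Prop :=
  ∃ (ρ : Fin k → R) (L : Fin k → List I) (q : Fin k → Half I R), Function.Injective ρ ∧
    (∀ j, EvenWalk E (.inr (ρ j)) (L j) (q j) ∧ s(q j, .inl (i, s)) ∈ E ∧ (L j).Nodup ∧ i ∉ L j) ∧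
    ∀ j j', j ≠ j' → (L j).Disjoint (L j')

theorem hasLinkage_of_fintype {E : Set (Sym2 (Half I R))} {i : I} {s : ℤˣ} {κ : Type*} [Fintype κ]
    (ρ : κ → R) (L : κ → List I) (q : κ → Half I R) (hρ : Function.Injective ρ)
    (h : ∀ j, EvenWalk E (.inr (ρ j)) (L j) (q j) ∧ s(q j, .inl (i, s)) ∈ E ∧ (L j).Nodup ∧ i ∉ L j)
    (hd : ∀ j j', j ≠ j' → (L j).Disjoint (L j')) : HasLinkage E i s (Fintype.card κ) := by
  let e := (Fintype.equivFin κ).symm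
  exact ⟨ρ ∘ e, L ∘ e, q ∘ e, hρ.comp e.injective, fun j => h (e j),
    fun j j' hj => hd _ _ fun h => hj (e.injective h)⟩

/-- Being ready to leave `(i, -s)` means having entered `i` through `(i, s)`. -/
theorem hasLinkage_one {E : Set (Sym2 (Half I R))} {i : I} {s : ℤˣ}
    (h : EvenReach E (.inl (i, -s))) : HasLinkage E i s 1 := by
  obtain ⟨ρ, L, w, hn⟩ := h
  rcases w.eq_nil_or_concat with ⟨_, h'⟩ | ⟨L', x, j, t, rfl, w', hx, h'⟩
  · cases h'
  · obtain ⟨rfl, ht⟩ := Prod.mk.inj (Sum.inl.inj h')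
    rw [neg_inj] at ht
    subst ht
    rw [List.nodup_append] at hn
    refine ⟨fun _ => ρ, fun _ => L', fun _ => x, Function.injective_of_subsingleton _,
      fun _ => ⟨w', hx, hn.1, fun hi => hn.2.2 _ hi _ (by simp) rfl⟩, fun j j' hj => ?_⟩
    exact absurd (Subsingleton.elim j j') hj

theorem evenReach_of_walk {E : Set (Sym2 (Half I R))} {i : I} {s : ℤˣ} {ρ : R} {L : List I}
    {q : Half I R} (w : EvenWalk E (.inr ρ) L q) (hq : s(q, .inl (i, s)) ∈ E) (hL : L.Nodup)
    (hi : i ∉ L) : EvenReach E (.inl (i, -s)) :=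
  ⟨ρ, _, w.concat hq, hL.append (List.nodup_singleton i) (by simpa using hi)⟩

open Classical in
/-- The vertices of which exactly one half can be left. -/
noncomputable def spine [Fintype I] (E : Set (Sym2 (Half I R))) : Finset I :=
  Finset.univ.filter fun i => (∃ s, EvenReach E (.inl (i, s))) ∧ ¬ IsBlossom E i

open Classical in
/-- The arcs of the digraph obtained by contracting the blossoms onto their bases. -/
noncomputable def arcs [Fintype I] [Fintype R] (E : Set (Sym2 (Half I R))) (b : I → Half I R) :
    Finset (Half I R × I) :=
  Finset.univ.filter fun a => a.2 ∈ spine E ∧ a.1 ≠ b a.2 ∧ ∃ q t, b a.2 = .inl (a.2, t) ∧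
    EvenReach E q ∧ baseOf b q = a.1 ∧ s(q, .inl (a.2, -t)) ∈ E

namespace BlossomStructure

variable [Fintype I] {E F : Set (Sym2 (Half I R))} {b : I → Half I R}

theorem exists_isBase (h : BlossomStructure E b F) {i : I} (hi : i ∈ spine E) :
    ∃ t, IsBase E (.inl (i, t)) ∧ b i = .inl (i, t) := by
  classical
  obtain ⟨-, ⟨t, ht⟩, hb⟩ := Finset.mem_filter.1 hi
  have : IsBase E (.inl (i, t)) := by
    refine ⟨ht, ?_⟩
    rintro j u ⟨⟩ hu
    refine hb fun s => ?_
    by_cases hs : s = -t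
    · exact hs ▸ hu
    · exact units_eq_of_ne_neg hs ▸ ht
  exact ⟨t, this, h.base_eq i t this⟩

theorem _root_.mem_spine_of_isBase {i : I} {t : ℤˣ} (hi : IsBase E (.inl (i, t))) : i ∈ spine E := by
  classical
  exact Finset.mem_filter.2 ⟨Finset.mem_univ _, ⟨t, hi.1⟩, hi.not_isBlossom⟩

theorem _root_.not_isBlossom_of_mem_spine {i : I} (hi : i ∈ spine E) : ¬ IsBlossom E i := by
  classical
  exact (Finset.mem_filter.1 hi).2.2

theorem injOn (h : BlossomStructure E b F) : Set.InjOn b (spine E) := by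
  intro i hi j hj hij
  obtain ⟨t, -, ht⟩ := h.exists_isBase hi
  obtain ⟨u, -, hu⟩ := h.exists_isBase hj
  rw [ht, hu] at hij
  exact (Prod.mk.inj (Sum.inl.inj hij)).1

/-- The base of a half-vertex that can be left is a source or the base of a vertex in the spine. -/
theorem baseOf_cases (h : BlossomStructure E b F) {q : Half I R} (hq : EvenReach E q) :
    (∃ ρ, baseOf b q = .inr ρ) ∨ ∃ m ∈ spine E, baseOf b q = b m := by
  have : IsBase E (baseOf b q) := by
    rcases q with ⟨i, s⟩ | ρ
    · exact h.isBase i s hq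
    · exact isBase_inr E ρ
  rcases hb : baseOf b q with ⟨i, s⟩ | ρ
  · rw [hb] at this
    exact .inr ⟨i, mem_spine_of_isBase this, (h.base_eq i s this).symm⟩
  · exact .inl ⟨ρ, rfl⟩

variable [Fintype R]

theorem _root_.mem_arcs {n : Half I R} {m : I} : (n, m) ∈ arcs E b ↔ m ∈ spine E ∧ n ≠ b m ∧
    ∃ q t, b m = .inl (m, t) ∧ EvenReach E q ∧ baseOf b q = n ∧ s(q, .inl (m, -t)) ∈ E := by
  classical
  simp [arcs]

/-- Contracting the blossoms along a walk. -/
theorem exists_contraction (h : BlossomStructure E b F) {ρ : R} {L : List I} {q : Half I R}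
    (w : EvenWalk E (.inr ρ) L q) (hL : L.Nodup) :
    ∃ f : I → Half I R,
      (∀ m ∈ spine E, m ∈ L → (f m, m) ∈ arcs E b ∧ f m ≠ baseOf b q ∧
        (f m = .inr ρ ∨ ∃ m' ∈ spine E, m' ∈ L ∧ f m = b m')) ∧
      Set.InjOn f {m | m ∈ spine E ∧ m ∈ L} ∧
      (baseOf b q = .inr ρ ∨ ∃ m' ∈ spine E, m' ∈ L ∧ baseOf b q = b m') := by
  classical
  induction L using List.reverseRecOn generalizing q with
  | nil =>
    cases w
    exact ⟨b, by simp, by simp, .inl rfl⟩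
  | append_singleton L i ih =>
    obtain ⟨x, s, w', hx, rfl⟩ := w.split_concat
    have hL' : L.Nodup := hL.of_append_left
    have hiL : i ∉ L := fun hi => (List.nodup_append.1 hL).2.2 _ hi _ (by simp) rfl
    have hex : EvenReach E x := ⟨ρ, L, w', hL'⟩
    have hei : EvenReach E (.inl (i, -s)) := ⟨ρ, _, w, hL⟩
    obtain ⟨f, hf, hinj, hb⟩ := ih w' hL'
    -- If `(i, s)` can also be left, `i` is a blossom vertex and the step stays within one base.
    -- Otherwise `(i, -s)` is a new base, and the step is an arc from the base of `x` to `i`.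
    by_cases his : EvenReach E (.inl (i, s))
    · have hbl : IsBlossom E i := fun u => by
        by_cases hu : u = -s
        · exact hu ▸ hei
        · exact units_eq_of_ne_neg hu ▸ his
      have hbx : baseOf b x = b i := h.adj _ _ hex his hx
      have hmem : ∀ m ∈ spine E, m ∈ L ++ [i] → m ∈ L := by
        intro m hm hmL
        rcases List.mem_append.1 hmL with hmL | hmL
        · exact hmL
        · rw [List.mem_singleton.1 hmL] at hm
          exact absurd hbl (not_isBlossom_of_mem_spine hm)
      refine ⟨f, fun m hm hmL => ?_, hinj.mono ?_, ?_⟩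
      · obtain ⟨h1, h2, h3⟩ := hf m hm (hmem m hm hmL)
        refine ⟨h1, by rwa [baseOf_inl, ← hbx], h3.imp_right ?_⟩
        rintro ⟨m', hm', hm'L, e⟩
        exact ⟨m', hm', List.mem_append_left _ hm'L, e⟩
      · rintro m ⟨hm, hmL⟩
        exact ⟨hm, hmem m hm hmL⟩
      · rw [baseOf_inl, ← hbx]
        refine hb.imp_right ?_
        rintro ⟨m', hm', hm'L, e⟩
        exact ⟨m', hm', List.mem_append_left _ hm'L, e⟩
    · have hib : IsBase E (.inl (i, -s)) := ⟨hei, by rintro j u ⟨⟩; rwa [neg_neg]⟩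
      have hisp : i ∈ spine E := mem_spine_of_isBase hib
      have hbi : b i = .inl (i, -s) := h.base_eq _ _ hib
      have hne : ∀ n : Half I R, (n = .inr ρ ∨ ∃ m' ∈ spine E, m' ∈ L ∧ n = b m') → n ≠ b i := by
        rintro n (rfl | ⟨m', hm', hm'L, rfl⟩) hn
        · rw [hbi] at hn; cases hn
        · exact hiL (h.injOn hm' hisp hn ▸ hm'L)
      have hup : ∀ m ∈ L, Function.update f i (baseOf b x) m = f m := fun m hm =>
        Function.update_of_ne (by rintro rfl; exact hiL hm) _ _
      refine ⟨Function.update f i (baseOf b x), fun m hm hmL => ?_, ?_, ?_⟩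
      · rcases List.mem_append.1 hmL with hmL | hmL
        · rw [hup m hmL]
          obtain ⟨h1, h2, h3⟩ := hf m hm hmL
          refine ⟨h1, hne _ h3, h3.imp_right ?_⟩
          rintro ⟨m', hm', hm'L, e⟩
          exact ⟨m', hm', List.mem_append_left _ hm'L, e⟩
        · rw [List.mem_singleton] at hmL
          subst hmL
          rw [Function.update_self]
          refine ⟨mem_arcs.2 ⟨hm, hne _ hb, x, -s, hbi, hex, rfl, by rwa [neg_neg]⟩, hne _ hb,
            hb.imp_right ?_⟩
          rintro ⟨m', hm', hm'L, e⟩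
          exact ⟨m', hm', List.mem_append_left _ hm'L, e⟩
      · rintro m ⟨hm, hmL⟩ m' ⟨hm', hm'L⟩ e
        simp only [List.mem_append, List.mem_singleton] at hmL hm'L
        rcases hmL with hmL | rfl <;> rcases hm'L with hm'L | rfl
        · rw [hup m hmL, hup m' hm'L] at e
          exact hinj ⟨hm, hmL⟩ ⟨hm', hm'L⟩ e
        · rw [hup m hmL, Function.update_self] at e
          exact absurd e (hf m hm hmL).2.1
        · rw [hup m' hm'L, Function.update_self] at e
          exact absurd e.symm (hf m' hm' hm'L).2.1
        · rfl
      · exact .inr ⟨i, hisp, by simp, rfl⟩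

/-- Linkages to a vertex of the spine yield transversals that miss many in-neighbours. -/
theorem exists_transversal (h : BlossomStructure E b F) {w : I} {t : ℤˣ}
    (hb : b w = .inl (w, t)) (hw : w ∈ spine E) {k : ℕ} (hk : HasLinkage E w (-t) k) :
    ∃ f, IsTransversal (spine E) b (arcs E b) f ∧ k ≤ (missed (spine E) (arcs E b) f w).card := by
  classical
  obtain ⟨ρ, L, q, hρ, hwalk, hd⟩ := hk
  choose f hf hinj hq using fun j => h.exists_contraction (hwalk j).1 (hwalk j).2.2.1
  have hsep : ∀ j j' (n : Half I R), (n = .inr (ρ j) ∨ ∃ m' ∈ spine E, m' ∈ L j ∧ n = b m') →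
      (n = .inr (ρ j') ∨ ∃ m' ∈ spine E, m' ∈ L j' ∧ n = b m') → j = j' := by
    rintro j j' n (rfl | ⟨m, hm, hmL, rfl⟩) (hn | ⟨m', hm', hm'L, hn⟩)
    · exact hρ (Sum.inr.inj hn)
    · obtain ⟨t, -, ht⟩ := h.exists_isBase hm'
      rw [ht] at hn; cases hn
    · obtain ⟨t, -, ht⟩ := h.exists_isBase hm
      rw [ht] at hn; cases hn
    · by_contra hne
      rw [h.injOn hm hm' hn] at hmL
      exact hd j j' hne hmL hm'L
  -- Predecessors on the contracted walks, and the own base elsewhere.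
  let g : I → Half I R := fun m => if hm : ∃ j, m ∈ L j then f hm.choose m else b m
  have hg : ∀ j m, m ∈ L j → g m = f j m := by
    intro j m hm
    have hex : ∃ j, m ∈ L j := ⟨j, hm⟩
    have : hex.choose = j := by
      by_contra hne
      exact hd _ _ hne hex.choose_spec hm
    simp only [g, dif_pos hex, this]
  have hg' : ∀ m, (∀ j, m ∉ L j) → g m = b m := fun m hm => dif_neg (by simpa using hm)
  have hsrc : ∀ j, ∀ m ∈ spine E, m ∈ L j → ∀ m' ∈ spine E, (∀ j, m' ∉ L j) → f j m ≠ b m' := by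
    intro j m hm hmL m' hm' hm'L e
    rcases (hf j m hm hmL).2.2 with h1 | ⟨m'', hm'', hm''L, h1⟩
    · obtain ⟨t, -, ht⟩ := h.exists_isBase hm'
      rw [h1, ht] at e; cases e
    · rw [h1] at e
      exact hm'L j (h.injOn hm'' hm' e ▸ hm''L)
  have hgt : IsTransversal (spine E) b (arcs E b) g := by
    refine ⟨?_, ?_⟩
    · intro m hm m' hm' e
      by_cases h1 : ∃ j, m ∈ L j <;> by_cases h2 : ∃ j, m' ∈ L j
      · obtain ⟨j, hj⟩ := h1
        obtain ⟨j', hj'⟩ := h2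
        rw [hg j m hj, hg j' m' hj'] at e
        have := hsep j j' _ (hf j m hm hj).2.2 (e ▸ (hf j' m' hm' hj').2.2)
        subst this
        exact hinj j ⟨hm, hj⟩ ⟨hm', hj'⟩ e
      · obtain ⟨j, hj⟩ := h1
        push Not at h2
        rw [hg j m hj, hg' m' h2] at e
        exact absurd e (hsrc j m hm hj m' hm' h2)
      · obtain ⟨j, hj⟩ := h2
        push Not at h1
        rw [hg j m' hj, hg' m h1] at e
        exact absurd e.symm (hsrc j m' hm' hj m hm h1)
      · push Not at h1 h2
        rw [hg' m h1, hg' m' h2] at e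
        exact h.injOn hm hm' e
    · intro m hm
      by_cases h1 : ∃ j, m ∈ L j
      · obtain ⟨j, hj⟩ := h1
        rw [hg j m hj]
        exact .inr (hf j m hm hj).1
      · push Not at h1
        exact .inl (hg' m h1)
  refine ⟨g, hgt, ?_⟩
  have hqne : ∀ j, ∀ m' ∈ spine E, m' ∉ L j → baseOf b (q j) ≠ b m' := by
    intro j m' hm' hm'L e
    rcases hq j with h1 | ⟨m'', hm'', hm''L, h1⟩
    · obtain ⟨t, -, ht⟩ := h.exists_isBase hm'
      rw [h1, ht] at e; cases e
    · rw [h1] at e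
      exact hm'L (h.injOn hm'' hm' e ▸ hm''L)
  -- The last base on each contracted walk is a predecessor only of `w`, which lies on none of the
  -- walks; so `g` misses it.
  have hmem : ∀ j, baseOf b (q j) ∈ missed (spine E) (arcs E b) g w := by
    intro j
    obtain ⟨hw1, hw2, hw3, hw4⟩ := hwalk j
    refine mem_missed.2 ⟨mem_arcs.2 ⟨hw, hqne j w hw hw4, q j, t, hb, ⟨_, _, hw1, hw3⟩, rfl, hw2⟩,
      fun m hm e => ?_⟩
    by_cases h1 : ∃ j, m ∈ L j
    · obtain ⟨j', hj'⟩ := h1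
      rw [hg j' m hj'] at e
      have := hsep j' j _ (hf j' m hm hj').2.2 (e ▸ hq j)
      subst this
      exact (hf j' m hm hj').2.1 e
    · push Not at h1
      rw [hg' m h1] at e
      exact hqne j m hm (h1 j) e.symm
  have hinjq : Function.Injective fun j => baseOf b (q j) :=
    fun j j' e => hsep j j' _ (hq j) (by
      have e' : baseOf b (q j) = baseOf b (q j') := e
      rw [e']; exact hq j')
  calc k = (Finset.univ.image fun j => baseOf b (q j)).card := by
        rw [Finset.card_image_of_injective _ hinjq]; simp
    _ ≤ _ := Finset.card_le_card (by
        intro n hn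
        obtain ⟨j, -, rfl⟩ := Finset.mem_image.1 hn
        exact hmem j)

/-- At most one walk of a linkage can end in a blossom vertex. -/
theorem linkage_le_one (h : BlossomStructure E b F) {i : I} (hi : IsBlossom E i) {s : ℤˣ} {k : ℕ}
    (hk : HasLinkage E i s k) : k ≤ 1 := by
  obtain ⟨ρ, L, q, hρ, hwalk, hd⟩ := hk
  by_contra hk1
  -- All walks end at the base of `i`. By contraction each of them starts at it or contains its
  -- vertex, so two of them cannot be disjoint.
  have hbase : ∀ j, baseOf b (q j) = b i := fun j =>
    h.adj _ _ ⟨_, _, (hwalk j).1, (hwalk j).2.2.1⟩ (hi s) (hwalk j).2.1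
  have hne : (⟨0, by omega⟩ : Fin k) ≠ ⟨1, by omega⟩ := by simp
  obtain ⟨-, -, -, h0⟩ := h.exists_contraction (hwalk ⟨0, by omega⟩).1 (hwalk ⟨0, by omega⟩).2.2.1
  obtain ⟨-, -, -, h1⟩ := h.exists_contraction (hwalk ⟨1, by omega⟩).1 (hwalk ⟨1, by omega⟩).2.2.1
  rw [hbase] at h0 h1
  rcases h0 with h0 | ⟨m, hm, hmL, h0⟩ <;> rcases h1 with h1 | ⟨m', hm', hm'L, h1⟩
  · exact hne (hρ (Sum.inr.inj (h0.symm.trans h1)))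
  · obtain ⟨t, -, ht⟩ := h.exists_isBase hm'
    rw [h0, ht] at h1; cases h1
  · obtain ⟨t, -, ht⟩ := h.exists_isBase hm
    rw [h1, ht] at h0; cases h0
  · rw [h.injOn hm hm' (h0.symm.trans h1)] at hmL
    exact hd _ _ hne hmL hm'L

end BlossomStructure

end EvenWalk

/-! ### From transversals back to linkages. -/

section EvenWalk

variable {I R : Type*}

/-- The step from the base of `m` to its predecessor `f m`. -/
def BackStep (X : Finset I) (b f : I → Half I R) (n n' : Half I R) : Prop :=
  ∃ m ∈ X, n = b m ∧ n' = f m ∧ f m ≠ b m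

open Relation

/-- Injectivity of `f` makes backward trajectories mergeless, and nothing precedes a value that `f`
misses. So trajectories from different missed values are disjoint. -/
theorem backStep_unique {X : Finset I} {b f : I → Half I R} (hf : Set.InjOn f X)
    {n₁ n₂ c : Half I R} (h₁ : ∀ m ∈ X, f m ≠ n₁) (h₂ : ∀ m ∈ X, f m ≠ n₂)
    (w₁ : ReflTransGen (BackStep X b f) n₁ c) (w₂ : ReflTransGen (BackStep X b f) n₂ c) :
    n₁ = n₂ := by
  induction w₁ with
  | refl =>
    rcases ReflTransGen.cases_tail w₂ with h | ⟨c, -, m, hm, -, h, -⟩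
    · exact h
    · exact absurd h.symm (h₁ m hm)
  | tail _ h ih =>
    obtain ⟨m, hm, rfl, rfl, -⟩ := h
    rcases ReflTransGen.cases_tail w₂ with h | ⟨c, hc, m', hm', rfl, h, -⟩
    · exact absurd h (h₂ m hm)
    · rw [hf hm hm' h] at ih
      exact ih hc

namespace BlossomStructure

variable [Fintype I] {E F G : Set (Sym2 (Half I R))} {b f : I → Half I R}
  {A : Finset (Half I R × I)}

/-- The edge set `G` contains a representative of every arc in `A`. -/
def Represents (E G : Set (Sym2 (Half I R))) (b : I → Half I R) (A : Finset (Half I R × I)) :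
    Prop :=
  ∀ n m, (n, m) ∈ A → m ∈ spine E ∧ n ≠ b m ∧ ∃ q t, b m = .inl (m, t) ∧ EvenReach E q ∧
    baseOf b q = n ∧ s(q, .inl (m, -t)) ∈ G

/-- Going back from `b m` to `f m`, delete `m` from `Y`. By injectivity `f m` is not attained on the
rest, so the induction applies and no base recurs; `hinv` keeps predecessors inside `Y`. Each arc is
expanded to a walk in `F` inside a blossom followed by its representative in `G`. -/
theorem exists_walk_to_base (h : BlossomStructure E b F) (hFG : F ⊆ G)
    (hA : Represents E G b A) (hf : IsTransversal (spine E) b A f) (Y : Finset I)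
    (hY : Y ⊆ spine E) (hinv : ∀ m ∈ spine E, m ∉ Y → ∀ y ∈ Y, f y ≠ b m) (n : Half I R)
    (hn : (∃ ρ, n = .inr ρ) ∨ ∃ m ∈ Y, n = b m) (hnY : ∀ y ∈ Y, f y ≠ n) :
    ∃ ρ L, EvenWalk G (.inr ρ) L n ∧ L.Nodup ∧
      (∀ x ∈ L, ((∃ m ∈ Y, b x = b m) ∨ b x = .inr ρ) ∧ (b x = n → ¬ IsBlossom E x) ∧
        ReflTransGen (BackStep (spine E) b f) n (b x)) ∧
      ReflTransGen (BackStep (spine E) b f) n (.inr ρ) := by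
  classical
  induction hc : Y.card using Nat.strong_induction_on generalizing Y n with
  | _ c ih =>
  subst hc
  rcases hn with ⟨ρ, rfl⟩ | ⟨m, hmY, rfl⟩
  · exact ⟨ρ, [], .nil _, List.nodup_nil, by simp, .refl⟩
  have hm := hY hmY
  have hfm : f m ≠ b m := hnY m hmY
  obtain ⟨-, -, q, t, hbm, hq, hbq, hqm⟩ := hA _ _ ((hf.2 m hm).resolve_left hfm)
  have hstep : BackStep (spine E) b f (b m) (f m) := ⟨m, hm, rfl, rfl, hfm⟩
  have hn' : (∃ ρ, f m = .inr ρ) ∨ ∃ m' ∈ Y.erase m, f m = b m' := by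
    rcases h.baseOf_cases hq with ⟨ρ, hρ⟩ | ⟨m', hm', he⟩
    · exact .inl ⟨ρ, hbq.symm.trans hρ⟩
    · have he' : f m = b m' := hbq.symm.trans he
      refine .inr ⟨m', Finset.mem_erase.2 ⟨?_, ?_⟩, he'⟩
      · rintro rfl; exact hfm he'
      · by_contra hm'Y
        exact hinv m' hm' hm'Y m hmY he'
  obtain ⟨ρ, L, w, hL, hLx, hρ⟩ := ih _ (Finset.card_erase_lt_of_mem hmY) (Y.erase m)
    ((Finset.erase_subset _ _).trans hY) (by
      intro m' hm' hm'Y y hy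
      by_cases e : m' = m
      · subst e; exact hnY y (Finset.mem_of_mem_erase hy)
      · exact hinv m' hm' (fun h' => hm'Y (Finset.mem_erase.2 ⟨e, h'⟩)) y
          (Finset.mem_of_mem_erase hy)) (f m) hn' (by
      intro y hy e
      exact Finset.ne_of_mem_erase hy (hf.1 (hY (Finset.mem_of_mem_erase hy)) hm e)) rfl
  obtain ⟨L₁, w₁, hL₁, hL₁x⟩ := h.inner q hq
  rw [hbq] at w₁ hL₁x
  have hnotL : ∀ x ∈ L, b x ≠ b m := by
    intro x hx e
    rcases (hLx x hx).1 with ⟨m', hm', e'⟩ | e'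
    · exact Finset.ne_of_mem_erase hm' (h.injOn (hY (Finset.mem_of_mem_erase hm')) hm
        (e'.symm.trans e))
    · rw [e', hbm] at e; cases e
  have hmb := not_isBlossom_of_mem_spine hm
  have hw := (w.append (w₁.mono hFG)).concat hqm
  rw [neg_neg, ← hbm] at hw
  refine ⟨ρ, _, hw, ?_, ?_, .head hstep hρ⟩
  · refine (hL.append hL₁ fun x h1 h2 => ?_).append (List.nodup_singleton m) fun x h1 h2 => ?_
    · exact (hLx x h1).2.1 (hL₁x x h2).2 (hL₁x x h2).1
    · rw [List.mem_singleton] at h2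
      subst h2
      rcases List.mem_append.1 h1 with h1 | h1
      · exact hnotL _ h1 rfl
      · exact hmb (hL₁x _ h1).1
  · intro x hx
    simp only [List.mem_append, List.mem_singleton] at hx
    rcases hx with (hx | hx) | rfl
    · refine ⟨(hLx x hx).1.imp_left ?_, fun e => absurd e (hnotL x hx),
        .head hstep (hLx x hx).2.2⟩
      rintro ⟨m', hm', e⟩
      exact ⟨m', Finset.mem_of_mem_erase hm', e⟩
    · obtain ⟨h1, h2⟩ := hL₁x x hx
      refine ⟨?_, fun e => absurd (h2.symm.trans e) hfm, h2 ▸ .single hstep⟩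
      rcases hn' with ⟨ρ', hρ'⟩ | ⟨m', hm', e⟩
      · rw [hρ'] at w
        exact .inr (h2.trans (hρ'.trans w.eq_nil_of_source.2.symm))
      · exact .inl ⟨m', Finset.mem_of_mem_erase hm', h2.trans e⟩
    · exact ⟨.inl ⟨x, hmY, rfl⟩, fun _ => hmb, .refl⟩

/-- As `f` is injective and fixes `w`, no proper backward step leads to `b w`; hence the walk avoids
everything with that base, in particular `w`. -/
theorem exists_walk_of_arc (h : BlossomStructure E b F) (hFG : F ⊆ G)
    (hA : Represents E G b A) (hf : IsTransversal (spine E) b A f) {w : I} {t : ℤˣ}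
    (hw : w ∈ spine E) (hbw : b w = .inl (w, t)) (hfw : f w = b w) {n : Half I R}
    (hn : (n, w) ∈ A) (hnf : ∀ m ∈ spine E, f m ≠ n) :
    ∃ ρ L q, EvenWalk G (.inr ρ) L q ∧ s(q, .inl (w, -t)) ∈ G ∧ L.Nodup ∧
      (∀ x ∈ L, b x ≠ b w ∧ ReflTransGen (BackStep (spine E) b f) n (b x)) ∧
      ReflTransGen (BackStep (spine E) b f) n (.inr ρ) := by
  obtain ⟨-, hnw, q, t', hbw', hq, hbq, hqw⟩ := hA n w hn
  have htt : t' = t := by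
    rw [hbw] at hbw'
    exact (Prod.mk.inj (Sum.inl.inj hbw')).2.symm
  subst htt
  have hnc : (∃ ρ, n = .inr ρ) ∨ ∃ m ∈ spine E, n = b m := hbq ▸ h.baseOf_cases hq
  obtain ⟨ρ, L, w₀, hL, hLx, hρ⟩ := h.exists_walk_to_base hFG hA hf (spine E) subset_rfl
    (fun m hm hm' => absurd hm hm') n hnc hnf
  obtain ⟨L₁, w₁, hL₁, hL₁x⟩ := h.inner q hq
  rw [hbq] at w₁ hL₁x
  have hback : ∀ c, ReflTransGen (BackStep (spine E) b f) n c → c ≠ b w := by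
    rintro c hc rfl
    rcases ReflTransGen.cases_tail hc with e | ⟨c', -, m, hm, -, e, hne⟩
    · exact hnw e.symm
    · have : w = m := hf.1 hw hm (hfw.trans e)
      subst this
      exact hne hfw
  refine ⟨ρ, L ++ L₁, q, w₀.append (w₁.mono hFG), hqw, ?_, ?_, hρ⟩
  · exact hL.append hL₁ fun x h1 h2 => (hLx x h1).2.1 (hL₁x x h2).2 (hL₁x x h2).1
  · intro x hx
    have hx' : ReflTransGen (BackStep (spine E) b f) n (b x) := by
      rcases List.mem_append.1 hx with hx | hx
      · exact (hLx x hx).2.2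
      · rw [(hL₁x x hx).2]
    exact ⟨hback _ hx', hx'⟩

/-- Every vertex of a walk has its base on the backward trajectory of the in-neighbour, and so does
the source. Disjoint trajectories therefore give disjoint walks from different sources. -/
theorem hasLinkage_inNbrs (h : BlossomStructure E b F) (hFG : F ⊆ G)
    (hA : Represents E G b A) (hf : IsTransversal (spine E) b A f) {w : I} {t : ℤˣ}
    (hw : w ∈ spine E) (hbw : b w = .inl (w, t)) (hfw : f w = b w)
    (hmiss : ∀ n, (n, w) ∈ A → n ∈ missed (spine E) A f w) :
    HasLinkage G w (-t) (inNbrs A w).card := by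
  classical
  have hmiss' : ∀ n ∈ inNbrs A w, ∀ m ∈ spine E, f m ≠ n := fun n hn =>
    (mem_missed.1 (hmiss n (mem_inNbrs.1 hn))).2
  choose ρ L q h1 h2 h3 h4 h5 using fun n : inNbrs A w => h.exists_walk_of_arc hFG hA hf hw hbw hfw
    (mem_inNbrs.1 n.2) (hmiss' n n.2)
  have := hasLinkage_of_fintype (E := G) (i := w) (s := -t) ρ L q ?_ ?_ ?_
  · rwa [Fintype.card_coe] at this
  · intro n n' e
    refine Subtype.ext (backStep_unique hf.1 (hmiss' n n.2) (hmiss' n' n'.2) (h5 n) ?_)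
    rw [e]; exact h5 n'
  · exact fun n => ⟨h1 n, h2 n, h3 n, fun hwL => (h4 n w hwL).1 rfl⟩
  · intro n n' hne x hx hx'
    exact hne (Subtype.ext (backStep_unique hf.1 (hmiss' n n.2) (hmiss' n' n'.2)
      (h4 n x hx).2 (h4 n' x hx').2))

end BlossomStructure

/-! ### The sparse set of edges. -/

open BlossomStructure

open Classical in
/-- A subset of the edges that preserves all linkages and has at most as many edges as the sum of the
sizes of the largest linkages. -/
theorem exists_sparse_edges [Fintype I] [Fintype R] {E : Set (Sym2 (Half I R))}
    (hE : NoAugmenting E) :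
    ∃ (G : Finset (Sym2 (Half I R))) (k : I → ℤˣ → ℕ), (G : Set _) ⊆ E ∧
      (∀ i s, HasLinkage (G : Set (Sym2 (Half I R))) i s (k i s)) ∧ (G.card ≤ ∑ i, ∑ s, k i s) ∧
      ∀ i s n, HasLinkage E i s n → n ≤ k i s := by
  obtain ⟨b, F, h, hcard⟩ := exists_blossomStructure hE
  obtain ⟨A, hAA, hthin⟩ := exists_thin_arcs h.injOn (arcs E b)
    (fun m hm => (mem_arcs.1 hm).2.1 rfl)
  have hex : ∀ a : Half I R × I, ∃ e : Sym2 (Half I R), a ∈ A → e ∈ E ∧ ∃ q t,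
      b a.2 = .inl (a.2, t) ∧ EvenReach E q ∧ baseOf b q = a.1 ∧ s(q, .inl (a.2, -t)) = e := by
    rintro ⟨n, m⟩
    by_cases ha : (n, m) ∈ A
    · obtain ⟨-, -, q, t, h1, h2, h3, h4⟩ := mem_arcs.1 (hAA ha)
      exact ⟨_, fun _ => ⟨h4, q, t, h1, h2, h3, rfl⟩⟩
    · exact ⟨s(n, n), fun h' => absurd h' ha⟩
  choose c hc using hex
  let G : Finset (Sym2 (Half I R)) := F ∪ A.image c
  have hFG : (F : Set (Sym2 (Half I R))) ⊆ (G : Set (Sym2 (Half I R))) :=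
    Finset.coe_subset.2 Finset.subset_union_left
  have hrep : Represents E (G : Set _) b A := by
    intro n m hnm
    obtain ⟨-, q, t, h1, h2, h3, h4⟩ := hc _ hnm
    obtain ⟨h5, h6, -⟩ := mem_arcs.1 (hAA hnm)
    refine ⟨h5, h6, q, t, h1, h2, h3, ?_⟩
    rw [h4]
    exact Finset.mem_coe.2 (Finset.mem_union_right _ (Finset.mem_image_of_mem c hnm))
  have hGE : (G : Set (Sym2 (Half I R))) ⊆ E := by
    intro e he
    rcases Finset.mem_union.1 (Finset.mem_coe.1 he) with he | he
    · exact h.subset he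
    · obtain ⟨a, ha, rfl⟩ := Finset.mem_image.1 he
      exact (hc a ha).1
  have hupper : ∀ w ∈ spine E, ∀ t, b w = .inl (w, t) → ∀ n, HasLinkage E w (-t) n →
      n ≤ (inNbrs A w).card := by
    intro w hw t ht n hn
    obtain ⟨f, hf, hle⟩ := h.exists_transversal ht hw hn
    exact hle.trans ((hthin w hw).2 f hf)
  have hblossom : ∀ i, IsBlossom E i → ∀ s,
      EvenReach (G : Set (Sym2 (Half I R))) (.inl (i, s)) := by
    intro i hi s
    obtain ⟨L, w, hL, hLx⟩ := h.inner _ (hi s)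
    rw [baseOf_inl] at w hLx
    rcases h.baseOf_cases (hi s) with ⟨ρ, hρ⟩ | ⟨m, hm, hρ⟩
    · rw [baseOf_inl] at hρ
      exact ⟨ρ, L, hρ ▸ w.mono hFG, hL⟩
    · rw [baseOf_inl] at hρ
      obtain ⟨t, hbase, ht⟩ := h.exists_isBase hm
      -- The base can be left in `E`, so at least one arc into `m` survived the thinning, and it
      -- yields a walk in `G` to the base.
      have hpos := hupper m hm t ht 1 (hasLinkage_one (by rw [neg_neg]; exact hbase.1))
      obtain ⟨n, hn⟩ := Finset.card_pos.1 hpos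
      obtain ⟨f, hf, hfm, hmiss⟩ := (hthin m hm).1
      obtain ⟨ρ, L', q, h1, h2, h3, h4, -⟩ := h.exists_walk_of_arc hFG hrep hf hm ht hfm
        (mem_inNbrs.1 hn) (mem_missed.1 (hmiss n (mem_inNbrs.1 hn))).2
      have h5 := h1.concat h2
      rw [neg_neg, ← ht, ← hρ] at h5
      refine ⟨ρ, _, h5.append (w.mono hFG), ?_⟩
      refine (h3.append (List.nodup_singleton m) fun x hx hxm => ?_).append hL fun x hx hxL => ?_
      · rw [List.mem_singleton] at hxm
        subst hxm
        exact (h4 _ hx).1 rfl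
      · obtain ⟨h6, h7⟩ := hLx x hxL
        rcases List.mem_append.1 hx with hx | hx
        · exact (h4 x hx).1 (h7.trans hρ)
        · rw [List.mem_singleton] at hx
          subst hx
          exact not_isBlossom_of_mem_spine hm h6
  -- A blossom vertex counts 1 for either sign; a spine vertex counts its in-degree, for the one
  -- sign with which it can be entered.
  refine ⟨G, fun i s => if IsBlossom E i then 1 else if i ∈ spine E ∧ b i = .inl (i, -s) then
    (inNbrs A i).card else 0, hGE, ?_, ?_, ?_⟩
  · intro i s
    dsimp only
    split_ifs with h1 h2
    · exact hasLinkage_one (hblossom i h1 _)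
    · obtain ⟨f, hf, hfm, hmiss⟩ := (hthin i h2.1).1
      have := h.hasLinkage_inNbrs hFG hrep hf h2.1 h2.2 hfm hmiss
      rwa [neg_neg] at this
    · exact ⟨Fin.elim0, Fin.elim0, Fin.elim0, fun j => j.elim0, fun j => j.elim0, fun j => j.elim0⟩
  · have hcA := card_eq_sum_card_inNbrs A
    have hcB : 2 * (Finset.univ.filter (IsBlossom E)).card =
        ∑ i : I, if IsBlossom E i then 2 else 0 := by
      rw [Finset.sum_ite, Finset.sum_const_zero, add_zero, Finset.sum_const, smul_eq_mul, mul_comm]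
    calc G.card ≤ F.card + (A.image c).card := Finset.card_union_le _ _
      _ ≤ 2 * (Finset.univ.filter (IsBlossom E)).card + A.card :=
          add_le_add hcard Finset.card_image_le
      _ = ∑ i, ((if IsBlossom E i then 2 else 0) + (inNbrs A i).card) := by
          rw [hcA, hcB, Finset.sum_add_distrib]
      _ ≤ _ := Finset.sum_le_sum fun i _ => ?_
    by_cases hi : IsBlossom E i
    · have : inNbrs A i = ∅ := by
        refine Finset.eq_empty_of_forall_notMem fun n hn => ?_
        exact not_isBlossom_of_mem_spine (hrep n i (mem_inNbrs.1 hn)).1 hi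
      simp [hi, this]
    · by_cases hs : i ∈ spine E
      · obtain ⟨t, -, ht⟩ := h.exists_isBase hs
        have : (inNbrs A i).card ≤ ∑ s : ℤˣ, if i ∈ spine E ∧ b i = .inl (i, -s) then
            (inNbrs A i).card else 0 := by
          refine le_trans ?_ (Finset.single_le_sum (f := fun s : ℤˣ =>
            if i ∈ spine E ∧ b i = .inl (i, -s) then (inNbrs A i).card else 0)
            (fun _ _ => Nat.zero_le _) (Finset.mem_univ (-t)))
          simp [hs, ht]
        simpa [hi] using this
      · have : inNbrs A i = ∅ := by
          refine Finset.eq_empty_of_forall_notMem fun n hn => ?_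
          exact hs (hrep n i (mem_inNbrs.1 hn)).1
        simp [hi, this]
  · intro i s n hn
    dsimp only
    split_ifs with h1 h2
    · exact h.linkage_le_one h1 hn
    · exact hupper i h2.1 (-s) h2.2 n (by rwa [neg_neg])
    -- A nonempty linkage would make `(i, -s)` leavable, hence the base of the spine vertex `i`,
    -- which is excluded here.
    · obtain ⟨ρ, L, q, -, hw, -⟩ := hn
      by_contra hpos
      obtain ⟨w1, w2, w3, w4⟩ := hw ⟨0, by omega⟩
      have hr := evenReach_of_walk w1 w2 w3 w4
      have hs : i ∈ spine E := Finset.mem_filter.2 ⟨Finset.mem_univ _, ⟨_, hr⟩, h1⟩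
      obtain ⟨t, hbase, ht⟩ := h.exists_isBase hs
      refine h2 ⟨hs, ht.trans ?_⟩
      by_contra hne
      have hst : s = t := by
        by_contra hne'
        refine hne ?_
        rw [units_eq_of_ne_neg (s := t) (t := -s) (by rw [neg_neg]; exact fun e => hne' e.symm)]
      subst hst
      exact hbase.2 i s rfl hr

end EvenWalk

/-! ### Translation between trails and walks on half-vertices. -/

namespace BidirectedGraph

variable {α β : Type*} {P : α → Prop} {Q : β → Prop}

/-- The half-vertex `p` represents the end `u` of the edge `e`: edges at the root `r` are sources,
and at all other vertices the half-vertex records the sign. -/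
def HalfAt (F : BidirectedGraph α β) (r : α) (e : β) (u : α) :
    Half (Subtype P) (Subtype Q) → Prop
  | .inl (v, s) => v.1 = u ∧ F.HasSign e u s
  | .inr ρ => ρ.1 = e ∧ u = r

/-- The edges of `F`, as pairs of half-vertices. -/
def halfEdges (F : BidirectedGraph α β) (r : α) :
    Set (Sym2 (Half (Subtype P) (Subtype Q))) :=
  {z | ∃ e u v p q, F.graph.IsLink e u v ∧ F.HalfAt r e u p ∧ F.HalfAt r e v q ∧ z = s(p, q)}

theorem mem_halfEdges {F : BidirectedGraph α β} {r : α} {p q : Half (Subtype P) (Subtype Q)} :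
    s(p, q) ∈ F.halfEdges r ↔
      ∃ e u v, F.graph.IsLink e u v ∧ F.HalfAt r e u p ∧ F.HalfAt r e v q := by
  constructor
  · rintro ⟨e, u, v, p', q', hl, hp, hq, h⟩
    rcases Sym2.eq_iff.1 h with ⟨rfl, rfl⟩ | ⟨rfl, rfl⟩
    · exact ⟨e, u, v, hl, hp, hq⟩
    · exact ⟨e, v, u, hl.symm, hq, hp⟩
  · rintro ⟨e, u, v, hl, hp, hq⟩
    exact ⟨e, u, v, p, q, hl, hp, hq, rfl⟩

/-- Consecutive steps of a trail fit together. -/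
def Follows (F : BidirectedGraph α β) (f g : OrientedEdge α β) : Prop :=
  g.tail = f.head ∧ ∃ s : ℤˣ, F.HasSign f.edge f.head s ∧ F.HasSign g.edge f.head (-s)

/-- Entering by one half and leaving by the other is the change of sign along a trail. The last step
`g` is kept apart because a walk stops before its final edge. -/
theorem exists_steps {F : BidirectedGraph α β} {r : α} {p q t : Half (Subtype P) (Subtype Q)}
    {L : List (Subtype P)} (w : EvenWalk (F.halfEdges r) p L q) (ht : s(q, t) ∈ F.halfEdges r) :
    ∃ (l : List (OrientedEdge α β)) (g : OrientedEdge α β),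
      (∀ f ∈ l ++ [g], F.graph.IsLink f.edge f.tail f.head) ∧ (l ++ [g]).IsChain F.Follows ∧
      (∀ f ∈ (l ++ [g]).head?, F.HalfAt r f.edge f.tail p) ∧
      l.map OrientedEdge.head = L.map Subtype.val ∧ F.HalfAt r g.edge g.head t := by
  induction w with
  | nil p =>
    obtain ⟨e, u, v, hl, hp, hq⟩ := mem_halfEdges.1 ht
    exact ⟨[], ⟨e, u, v⟩, by simpa using hl, by simp, by simpa using hp, rfl, hq⟩
  | @cons p q i s L h _ ih =>
    obtain ⟨l, g, h1, h2, h3, h4, h5⟩ := ih ht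
    obtain ⟨e, u, v, hl, hp, hi, hs⟩ := mem_halfEdges.1 h
    refine ⟨⟨e, u, v⟩ :: l, g, ?_, ?_, by simpa using hp, by simp [h4, hi], h5⟩
    · intro f hf
      rcases List.mem_cons.1 hf with rfl | hf
      · exact hl
      · exact h1 f hf
    · rw [List.cons_append, List.isChain_cons]
      refine ⟨fun f hf => ?_, h2⟩
      obtain ⟨h6, h7⟩ := h3 f hf
      refine ⟨h6.symm.trans hi, s, hs, ?_⟩
      rw [← h6, hi] at h7
      exact h7

theorem exists_evenWalk {F : BidirectedGraph α β} {r : α} {t : Half (Subtype P) (Subtype Q)}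
    (l : List (OrientedEdge α β)) (g : OrientedEdge α β)
    (hlink : ∀ f ∈ l ++ [g], F.graph.IsLink f.edge f.tail f.head)
    (hchain : (l ++ [g]).IsChain F.Follows) (hP : ∀ f ∈ l, P f.head)
    (ht : F.HalfAt r g.edge g.head t) (p : Half (Subtype P) (Subtype Q))
    (hp : ∀ f ∈ (l ++ [g]).head?, F.HalfAt r f.edge f.tail p) :
    ∃ L q, EvenWalk (F.halfEdges r) p L q ∧ s(q, t) ∈ F.halfEdges r ∧
      L.map Subtype.val = l.map OrientedEdge.head := by
  induction l generalizing p with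
  | nil =>
    exact ⟨[], p, .nil p, mem_halfEdges.2 ⟨g.edge, g.tail, g.head, hlink g (by simp),
      hp g (by simp), ht⟩, rfl⟩
  | cons f l ih =>
    rw [List.cons_append, List.isChain_cons] at hchain
    obtain ⟨f', hf'⟩ : ∃ f', (l ++ [g]).head? = some f' := by
      cases l <;> simp
    obtain ⟨htail, s, hs, hs'⟩ := hchain.1 f' (by simp [hf'])
    obtain ⟨L, q, w, hq, hL⟩ := ih (fun f hf => hlink f (List.mem_cons_of_mem _ hf)) hchain.2
      (fun f hf => hP f (List.mem_cons_of_mem _ hf)) (.inl (⟨f.head, hP f (by simp)⟩, -s)) (by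
        intro f'' hf''
        rw [hf', Option.mem_def, Option.some.injEq] at hf''
        subst hf''
        exact ⟨htail.symm, htail ▸ hs'⟩)
    refine ⟨⟨f.head, hP f (by simp)⟩ :: L, q, .cons (mem_halfEdges.2 ⟨f.edge, f.tail, f.head,
      hlink f (by simp), hp f (by simp), rfl, hs⟩) w, hq, by simp [hL]⟩

/-- A repeated edge has the same two ends, so the head of its later occurrence would be an end of
the earlier one, a vertex already visited. -/
theorem nodup_edges {F : BidirectedGraph α β} {u : α} {l : List (OrientedEdge α β)}
    (hlink : ∀ f ∈ l, F.graph.IsLink f.edge f.tail f.head) (hchain : l.IsChain F.Follows)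
    (hu : ∀ f ∈ l.head?, f.tail = u) (hnd : (u :: l.map OrientedEdge.head).Nodup) :
    (l.map OrientedEdge.edge).Nodup := by
  induction l generalizing u with
  | nil => simp
  | cons f l ih =>
    rw [List.isChain_cons] at hchain
    rw [List.map_cons, List.nodup_cons]
    rw [List.map_cons, List.nodup_cons, List.nodup_cons] at hnd
    refine ⟨fun hf => ?_, ih (fun g hg => hlink g (List.mem_cons_of_mem _ hg)) hchain.2
      (fun g hg => (hchain.1 g hg).1) (List.nodup_cons.2 hnd.2)⟩
    obtain ⟨g, hg, hge⟩ := List.mem_map.1 hf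
    have h1 := hlink f (by simp)
    have h2 := hlink g (List.mem_cons_of_mem _ hg)
    rw [hge] at h2
    have hgl : g.head ∈ l.map OrientedEdge.head := List.mem_map_of_mem hg
    rcases h2.right_eq_or_eq h1 with h3 | h3
    · refine hnd.1 (List.mem_cons_of_mem _ ?_)
      rw [← hu f (by simp), ← h3]
      exact hgl
    · exact hnd.2.1 (h3 ▸ hgl)

theorem exists_isSignedPath {F : BidirectedGraph α β} {r : α} (hr : r ∈ V(F.graph))
    (hP : ∀ v, P v → v ≠ r) {ρ : Subtype Q} {L : List (Subtype P)}
    {q : Half (Subtype P) (Subtype Q)} {v : Subtype P} {s : ℤˣ}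
    (w : EvenWalk (F.halfEdges r) (.inr ρ) L q) (hq : s(q, .inl (v, s)) ∈ F.halfEdges r)
    (hL : L.Nodup) (hv : v ∉ L) :
    ∃ T : TrailSeq α β, F.IsSignedPath r v s T ∧ T.edges.head? = some ρ.1 ∧
      T.interior = L.map Subtype.val := by
  obtain ⟨l, g, h1, h2, h3, h4, h5, h6⟩ := exists_steps w hq
  have hnd : (r :: (l ++ [g]).map OrientedEdge.head).Nodup := by
    rw [List.map_append, h4, List.map_singleton, ← h5, List.nodup_cons]
    constructor
    · simp only [List.mem_append, List.mem_map, List.mem_singleton]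
      rintro (⟨x, -, hx⟩ | hx)
      · exact hP x x.2 hx
      · exact hP v v.2 hx.symm
    · refine (hL.map Subtype.val_injective).append (List.nodup_singleton _) ?_
      intro x hx hxv
      rw [List.mem_singleton] at hxv
      obtain ⟨y, hy, rfl⟩ := List.mem_map.1 hx
      exact hv (Subtype.ext hxv ▸ hy)
  obtain ⟨f₀, hf₀⟩ : ∃ f', (l ++ [g]).head? = some f' := by
    cases l <;> simp
  have hρ := h3 f₀ (by simp [hf₀])
  have hu : ∀ f ∈ (l ++ [g]).head?, f.tail = r := fun f hf => (h3 f hf).2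
  refine ⟨⟨r, l ++ [g]⟩, ⟨⟨⟨hr, h1, hu, h2, nodup_edges h1 h2 hu hnd⟩, hnd⟩, rfl, g, by simp,
    h5.symm, h5 ▸ h6⟩, ?_, ?_⟩
  · simp only [TrailSeq.edges, List.head?_map, hf₀, Option.map_some, hρ.1]
  · simp only [TrailSeq.interior, List.dropLast_concat, h4]

/-- The steps of a walk between different sources form an almost path from `r` to `r`. Inner
vertices avoid `r`, so the last edge could only repeat the first, and then the sources would
coincide. -/
theorem noAugmenting {F : BidirectedGraph α β} {r : α} (hr : r ∈ V(F.graph))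
    (hP : ∀ v, P v → v ≠ r) (hF : F.IsClean r) :
    NoAugmenting (F.halfEdges r : Set (Sym2 (Half (Subtype P) (Subtype Q)))) := by
  intro ρ ρ' L y w hL hy
  by_contra hne
  have hne' : ρ.1 ≠ ρ'.1 := fun h => hne (Subtype.ext h)
  obtain ⟨l, g, h1, h2, h3, h4, h5, h6⟩ := exists_steps w hy
  have hhead : ∀ f ∈ l, f.head ≠ r := by
    intro f hf
    have : f.head ∈ L.map Subtype.val := h4 ▸ List.mem_map_of_mem hf
    obtain ⟨x, -, hx⟩ := List.mem_map.1 this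
    exact hx ▸ hP x x.2
  have hnd : (r :: l.map OrientedEdge.head).Nodup := by
    rw [List.nodup_cons]
    constructor
    · intro h
      obtain ⟨f, hf, h⟩ := List.mem_map.1 h
      exact hhead f hf h
    · rw [h4]; exact hL.map Subtype.val_injective
  have hu : ∀ f ∈ (l ++ [g]).head?, f.tail = r := fun f hf => (h3 f hf).2
  have hl1 : ∀ f ∈ l, F.graph.IsLink f.edge f.tail f.head :=
    fun f hf => h1 f (List.mem_append_left _ hf)
  have hl2 : l.IsChain F.Follows := h2.left_of_append
  have hlu : ∀ f ∈ l.head?, f.tail = r ∧ f.edge = ρ.1 := by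
    intro f hf
    have := h3 f (by
      cases l with
      | nil => simp at hf
      | cons a l => simpa using hf)
    exact ⟨this.2, this.1.symm⟩
  have hnl : (l.map OrientedEdge.edge).Nodup := nodup_edges hl1 hl2 (fun f hf => (hlu f hf).1) hnd
  have htail : ∀ f ∈ l, f.tail = r → f ∈ l.head? := by
    intro f hf hfr
    obtain ⟨l₁, l₂, rfl⟩ := List.append_of_mem hf
    rcases l₁.eq_nil_or_concat with rfl | ⟨l₁, a, rfl⟩
    · simp
    · exfalso
      rw [List.concat_eq_append, List.append_assoc] at hl2 hhead
      have h7 := hl2.right_of_append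
      rw [List.singleton_append, List.isChain_cons_cons] at h7
      exact hhead a (by simp) (h7.1.1.symm.trans hfr)
  have hedges : ((l ++ [g]).map OrientedEdge.edge).Nodup := by
    rw [List.map_append]
    refine hnl.append (List.nodup_singleton _) ?_
    intro e he heg
    obtain ⟨f, hf, rfl⟩ := List.mem_map.1 he
    rw [List.mem_map] at heg
    obtain ⟨g', hg', heg⟩ := heg
    rw [List.mem_singleton] at hg'
    subst hg'
    have h7 := h1 g' (by simp)
    rw [heg, h6] at h7
    rcases h7.right_eq_or_eq (hl1 f hf) with h8 | h8
    · exact hne' ((hlu f (htail f hf h8.symm)).2.symm.trans (heg.symm.trans h5.symm))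
    · exact hhead f hf h8.symm
  by_cases hl : l = []
  · subst hl
    have := h3 g (by simp)
    exact hne' (this.1.trans h5.symm)
  refine hF ⟨⟨r, l ++ [g]⟩, ⟨⟨hr, h1, hu, h2, hedges⟩, .inr ?_⟩, by simp, rfl, ?_⟩
  · simp only [TrailSeq.dropLastEdge, List.dropLast_concat]
    exact ⟨⟨hr, hl1, fun f hf => (hlu f hf).1, hl2, hnl⟩, hnd⟩
  · simp [TrailSeq.terminal, h6]

theorem exists_evenWalk_of_isSignedPath {F : BidirectedGraph α β} {r : α}
    (hP : ∀ v ∈ V(F.graph), v ≠ r → P v) (hQ : ∀ e, F.graph.Inc e r → Q e) {v : Subtype P} {s : ℤˣ}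
    {T : TrailSeq α β} (hT : F.IsSignedPath r v s T) :
    ∃ (ρ : Subtype Q) (L : List (Subtype P)) (q : Half (Subtype P) (Subtype Q)),
      EvenWalk (F.halfEdges r) (.inr ρ) L q ∧ s(q, .inl (v, s)) ∈ F.halfEdges r ∧ L.Nodup ∧
      v ∉ L ∧ L.map Subtype.val = T.interior ∧ T.edges.head? = some ρ.1 := by
  obtain ⟨start, steps⟩ := T
  obtain ⟨⟨⟨hr, hlink, hstart, hchain, -⟩, hnd⟩, rfl, g, hg, hgv, hgs⟩ := hT
  dsimp only at *
  obtain ⟨l, rfl⟩ : ∃ l, steps = l ++ [g] := by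
    rcases steps.eq_nil_or_concat with rfl | ⟨l, a, rfl⟩
    · simp at hg
    · simp only [List.concat_eq_append, List.getLast?_append, List.getLast?_singleton,
        Option.some_or, Option.mem_def, Option.some.injEq] at hg
      exact ⟨l, by simp [hg]⟩
  simp only [TrailSeq.vertices, List.map_append, List.map_singleton] at hnd
  rw [List.nodup_cons] at hnd
  obtain ⟨f₀, hf₀⟩ : ∃ f', (l ++ [g]).head? = some f' := by
    cases l <;> simp
  have hf₀m : f₀ ∈ l ++ [g] := List.mem_of_mem_head? (by simp [hf₀])
  have hf₀t : f₀.tail = start := hstart f₀ (by simp [hf₀])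
  have hinc : F.graph.Inc f₀.edge start := hf₀t ▸ (hlink f₀ hf₀m).inc_left
  obtain ⟨L, q, w, hq, hL⟩ := exists_evenWalk (F := F) (r := start) (P := P) (Q := Q)
    (t := .inl (v, s)) l g hlink hchain
    (fun f hf => hP _ (hlink f (List.mem_append_left _ hf)).right_mem (by
      intro h
      exact hnd.1 (List.mem_append_left _ (h ▸ List.mem_map_of_mem hf))))
    ⟨hgv.symm, hgv ▸ hgs⟩ (.inr ⟨f₀.edge, hQ _ hinc⟩) (by
      intro f hf
      rw [hf₀, Option.mem_def, Option.some.injEq] at hf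
      subst hf
      exact ⟨rfl, hf₀t⟩)
  refine ⟨_, L, q, w, hq, ?_, ?_, ?_, ?_⟩
  · refine List.Nodup.of_map Subtype.val ?_
    rw [hL]; exact hnd.2.of_append_left
  · intro hv
    have : g.head ∈ l.map OrientedEdge.head := by
      rw [← hL, hgv]; exact List.mem_map_of_mem hv
    exact (List.nodup_append.1 hnd.2).2.2 _ this _ (by simp) rfl
  · simp [TrailSeq.interior, hL]
  · simp only [TrailSeq.edges, List.head?_map, hf₀, Option.map_some]

/-- Internally disjoint paths with the same first edge are equal. -/
theorem IsSignedPath.eq_of_head_eq {F : BidirectedGraph α β} {r v : α} {s : ℤˣ}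
    {T T' : TrailSeq α β} (hT : F.IsSignedPath r v s T) (hT' : F.IsSignedPath r v s T')
    (hd : T.InternallyDisjoint T') {e : β} (he : T.edges.head? = some e)
    (he' : T'.edges.head? = some e) : T = T' := by
  obtain ⟨start, steps⟩ := T
  obtain ⟨start', steps'⟩ := T'
  obtain ⟨⟨⟨-, hlink, hstart, -, -⟩, hnd⟩, rfl, g, hg, hgv, -⟩ := hT
  obtain ⟨⟨⟨-, hlink', hstart', -, -⟩, hnd'⟩, hs, g', hg', hgv', -⟩ := hT'
  dsimp only at *
  subst hs
  rcases steps with _ | ⟨f, l⟩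
  · simp at hg
  rcases steps' with _ | ⟨f', l'⟩
  · simp at hg'
  simp only [TrailSeq.edges, List.map_cons, List.head?_cons, Option.some.injEq] at he he'
  have ht := hstart f (by simp)
  have ht' := hstart' f' (by simp)
  have h1 := hlink f (by simp)
  have h2 := hlink' f' (by simp)
  rw [ht, he] at h1
  rw [ht', he'] at h2
  have hhead := h1.right_unique h2
  have hff : f = f' := by
    cases f; cases f'; simp_all
  subst hff
  have aux : ∀ (l : List (OrientedEdge α β)) (g : OrientedEdge α β), g ∈ (f :: l).getLast? →
      g.head = f.head → ((f :: l).map OrientedEdge.head).Nodup → l = [] := by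
    intro l g hg hgf hn
    by_contra hl
    rw [List.map_cons, List.nodup_cons] at hn
    refine hn.1 (hgf ▸ List.mem_map_of_mem (List.mem_of_mem_getLast? ?_))
    obtain ⟨a, l, rfl⟩ := List.exists_cons_of_ne_nil hl
    simpa using hg
  have hn := (List.nodup_cons.1 hnd).2
  have hn' := (List.nodup_cons.1 hnd').2
  simp only at hn hn'
  by_cases hl : l = []
  · subst hl
    simp only [List.getLast?_singleton, Option.mem_def, Option.some.injEq] at hg
    subst hg
    rw [aux l' g' hg' (hgv'.trans hgv.symm) hn']
  · by_cases hl' : l' = []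
    · subst hl'
      simp only [List.getLast?_singleton, Option.mem_def, Option.some.injEq] at hg'
      subst hg'
      rw [aux l g hg (hgv.trans hgv'.symm) hn]
    · exfalso
      obtain ⟨a, l, rfl⟩ := List.exists_cons_of_ne_nil hl
      obtain ⟨a', l', rfl⟩ := List.exists_cons_of_ne_nil hl'
      exact hd (a := f.head) (by simp [TrailSeq.interior]) (by simp [TrailSeq.interior])

end BidirectedGraph

/-! ### Spanning subgraphs and the conclusion. -/

theorem HasLinkage.mono {I R : Type*} {E E' : Set (Sym2 (Half I R))} (hE : E ⊆ E') {i : I} {s : ℤˣ}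
    {k : ℕ} (h : HasLinkage E i s k) : HasLinkage E' i s k := by
  obtain ⟨ρ, L, q, h1, h2, h3⟩ := h
  exact ⟨ρ, L, q, h1, fun j => ⟨(h2 j).1.mono hE, hE (h2 j).2.1, (h2 j).2.2⟩, h3⟩

namespace BidirectedGraph

variable {α β : Type*} {P : α → Prop} {Q : β → Prop}

/-- The spanning subgraph with the edges in `S`. -/
def restrict (B : BidirectedGraph α β) (S : Set β) : BidirectedGraph α β where
  graph := B.graph.restrict S
  loopless := by
    have := B.loopless
    exact Graph.Loopless.anti (G := B.graph) Graph.restrict_le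
  finite_vertexSet := B.finite_vertexSet
  finite_edgeSet := B.finite_edgeSet.subset Set.inter_subset_left
  sign h := B.sign ⟨h.1, (Graph.restrict_inc.1 h.2).1⟩

theorem restrict_hasSign {B : BidirectedGraph α β} {S : Set β} {e : β} {u : α} {s : ℤˣ} :
    (B.restrict S).HasSign e u s ↔ e ∈ S ∧ B.HasSign e u s := by
  constructor
  · rintro ⟨h, hs⟩
    exact ⟨(Graph.restrict_inc.1 h).2, (Graph.restrict_inc.1 h).1, hs⟩
  · rintro ⟨he, h, hs⟩
    exact ⟨Graph.restrict_inc.2 ⟨h, he⟩, hs⟩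

theorem restrict_isSpanningSubgraph (B : BidirectedGraph α β) (S : Set β) :
    (B.restrict S).IsSpanningSubgraph B where
  graph_le := ⟨Graph.restrict_le, rfl⟩
  sign_eq _ _ _ h := (restrict_hasSign.1 h).2

theorem IsSignedPath.of_restrict {B : BidirectedGraph α β} {S : Set β} {x y : α} {s : ℤˣ}
    {T : TrailSeq α β} (h : (B.restrict S).IsSignedPath x y s T) : B.IsSignedPath x y s T := by
  obtain ⟨⟨⟨h1, h2, h3, h4, h5⟩, h6⟩, h7, f, hf, hfy, hfs⟩ := h
  refine ⟨⟨⟨h1, fun f hf => (h2 f hf).2, h3, h4.imp ?_, h5⟩, h6⟩, h7, f, hf, hfy,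
    (restrict_hasSign.1 hfs).2⟩
  rintro f g ⟨hfg, s, hs, hs'⟩
  exact ⟨hfg, s, (restrict_hasSign.1 hs).2, (restrict_hasSign.1 hs').2⟩

/-- The sources are the first edges; they differ for distinct paths by `IsSignedPath.eq_of_head_eq`,
also when the interiors are empty. -/
theorem hasLinkage_of_paths {B : BidirectedGraph α β} {r : α}
    (hP : ∀ v ∈ V(B.graph), v ≠ r → P v) (hQ : ∀ e, B.graph.Inc e r → Q e) {v : Subtype P} {s : ℤˣ}
    {W : Finset (TrailSeq α β)} (h : ∀ T ∈ W, B.IsSignedPath r v s T)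
    (hd : (W : Set (TrailSeq α β)).Pairwise TrailSeq.InternallyDisjoint) :
    HasLinkage (B.halfEdges r : Set (Sym2 (Half (Subtype P) (Subtype Q)))) v s W.card := by
  choose ρ L q h1 h2 h3 h4 h5 h6 using fun T : W =>
    exists_evenWalk_of_isSignedPath (Q := Q) hP hQ (h T T.2)
  have := hasLinkage_of_fintype (E := B.halfEdges r) (i := v) (s := s) ρ L q ?_
    (fun T => ⟨h1 T, h2 T, h3 T, h4 T⟩) ?_
  · rwa [Fintype.card_coe] at this
  · intro T T' e
    by_contra hne
    have hne' : T.1 ≠ T'.1 := fun h => hne (Subtype.ext h)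
    exact hne' ((h T T.2).eq_of_head_eq (h T' T'.2) (hd T.2 T'.2 hne') (h6 T) (e ▸ h6 T'))
  · intro T T' hne x hx hx'
    have hne' : T.1 ≠ T'.1 := fun h => hne (Subtype.ext h)
    refine hd T.2 T'.2 hne' (a := x.1) ?_ ?_
    · rw [← h5]; exact List.mem_map_of_mem hx
    · rw [← h5]; exact List.mem_map_of_mem hx'

theorem exists_paths_of_hasLinkage {F : BidirectedGraph α β} {r : α} (hr : r ∈ V(F.graph))
    (hP : ∀ v, P v → v ≠ r) {v : Subtype P} {s : ℤˣ} {k : ℕ}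
    (h : HasLinkage (F.halfEdges r : Set (Sym2 (Half (Subtype P) (Subtype Q)))) v s k) :
    ∃ W : Finset (TrailSeq α β), (∀ T ∈ W, F.IsSignedPath r v s T) ∧
      (W : Set (TrailSeq α β)).Pairwise TrailSeq.InternallyDisjoint ∧ W.card = k := by
  classical
  obtain ⟨ρ, L, q, hρ, hw, hd⟩ := h
  choose T hT hTe hTi using fun j =>
    exists_isSignedPath hr hP (hw j).1 (hw j).2.1 (hw j).2.2.1 (hw j).2.2.2
  have hinj : Function.Injective T := by
    intro j j' e
    refine hρ (Subtype.ext (Option.some.inj ?_))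
    rw [← hTe j, ← hTe j', e]
  refine ⟨Finset.univ.image T, by simpa using hT, ?_, by
    rw [Finset.card_image_of_injective _ hinj]; simp⟩
  intro T₁ h₁ T₂ h₂ hne x hx hx'
  simp only [Finset.coe_image, Finset.coe_univ, Set.image_univ, Set.mem_range] at h₁ h₂
  obtain ⟨j, rfl⟩ := h₁
  obtain ⟨j', rfl⟩ := h₂
  rw [hTi] at hx hx'
  obtain ⟨y, hy, rfl⟩ := List.mem_map.1 hx
  obtain ⟨y', hy', e⟩ := List.mem_map.1 hx'
  rw [Subtype.ext e] at hy'
  exact hd j j' (fun e => hne (by rw [e])) hy hy'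

end BidirectedGraph

open BidirectedGraph

theorem mainTheorem7 {α β : Type*} (B : BidirectedGraph α β) (r : α)
    (hr : r ∈ V(B.graph)) (hB : B.IsClean r) :
    ∃ F : BidirectedGraph α β, F.IsSpanningSubgraph B ∧ F.IsVertexFlame r ∧
      ∀ v ∈ V(B.graph), v ≠ r → ∀ s : ℤˣ, F.kappa s r v = B.kappa s r v := by
  classical
  let P : α → Prop := fun v => v ∈ V(B.graph) ∧ v ≠ r
  let Q : β → Prop := fun e => B.graph.Inc e r
  have hPr : ∀ v, P v → v ≠ r := fun v hv => hv.2
  have : Finite (Subtype P) := (B.finite_vertexSet.subset fun v hv => hv.1 :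
    Set.Finite {v | P v}).to_subtype
  have : Finite (Subtype Q) := (B.finite_edgeSet.subset fun e he => Graph.Inc.edge_mem he :
    Set.Finite {e | Q e}).to_subtype
  have := Fintype.ofFinite (Subtype P)
  have := Fintype.ofFinite (Subtype Q)
  obtain ⟨G, k, hG, hk, hcard, hmax⟩ := exists_sparse_edges (noAugmenting (P := P) (Q := Q) hr hPr hB)
  have hex : ∀ z : G, ∃ e u v p q, B.graph.IsLink e u v ∧ B.HalfAt r e u p ∧ B.HalfAt r e v q ∧
      z.1 = s(p, q) := fun z => hG z.2
  choose e u v p q hl hp hq hz using hex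
  -- One edge of `B` is chosen for every pair in `G`, so there are at most `G.card` of them.
  let S : Finset β := Finset.univ.image e
  let F := B.restrict (S : Set β)
  have hhalf : ∀ (e : β) (u : α) (p : Half (Subtype P) (Subtype Q)), e ∈ S → B.HalfAt r e u p →
      F.HalfAt r e u p := by
    rintro e u (⟨v, s⟩ | ρ) he h
    · exact ⟨h.1, restrict_hasSign.2 ⟨he, h.2⟩⟩
    · exact h
  have hGF : (G : Set (Sym2 (Half (Subtype P) (Subtype Q)))) ⊆ F.halfEdges r := by
    intro z hzG
    have hS : e ⟨z, hzG⟩ ∈ S := Finset.mem_image_of_mem e (Finset.mem_univ _)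
    exact ⟨e ⟨z, hzG⟩, u ⟨z, hzG⟩, v ⟨z, hzG⟩, p ⟨z, hzG⟩, q ⟨z, hzG⟩, ⟨hS, hl _⟩,
      hhalf _ _ _ hS (hp _), hhalf _ _ _ hS (hq _), hz ⟨z, hzG⟩⟩
  have hub : ∀ (v : Subtype P) (s : ℤˣ) (W : Finset (TrailSeq α β)),
      (∀ T ∈ W, B.IsSignedPath r v s T) →
      (W : Set (TrailSeq α β)).Pairwise TrailSeq.InternallyDisjoint → W.card ≤ k v s :=
    fun v s W h1 h2 => hmax v s _ (hasLinkage_of_paths (fun v hv hvr => ⟨hv, hvr⟩)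
      (fun _ he => he) h1 h2)
  -- In both graphs the maximum is `k v s`: linkages in `G` give that many paths already in `F`, and
  -- `B` has no larger system.
  have hkF : ∀ (v : Subtype P) (s : ℤˣ), F.kappa s r v = k v s := by
    intro v s
    refine IsGreatest.csSup_eq ⟨?_, ?_⟩
    · exact exists_paths_of_hasLinkage (F := F) hr hPr ((hk v s).mono hGF)
    · rintro n ⟨W, h1, h2, rfl⟩
      exact hub v s W (fun T hT => (h1 T hT).of_restrict) h2
  have hkB : ∀ (v : Subtype P) (s : ℤˣ), B.kappa s r v = k v s := by
    intro v s
    refine IsGreatest.csSup_eq ⟨?_, ?_⟩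
    · obtain ⟨W, h1, h2, h3⟩ := exists_paths_of_hasLinkage (F := F) hr hPr ((hk v s).mono hGF)
      exact ⟨W, fun T hT => (h1 T hT).of_restrict, h2, h3⟩
    · rintro n ⟨W, h1, h2, rfl⟩
      exact hub v s W h1 h2
  refine ⟨F, restrict_isSpanningSubgraph B _, ?_, fun v hv hvr s =>
    (hkF ⟨v, hv, hvr⟩ s).trans (hkB ⟨v, hv, hvr⟩ s).symm⟩
  calc E(F.graph).ncard ≤ (S : Set β).ncard :=
        Set.ncard_le_ncard Set.inter_subset_right S.finite_toSet
    _ = S.card := Set.ncard_coe_finset S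
    _ ≤ G.card := Finset.card_image_le.trans (by simp)
    _ ≤ ∑ v : Subtype P, ∑ s, k v s := hcard
    _ = ∑ v : Subtype P, ∑ s, F.kappa s r v :=
        Finset.sum_congr rfl fun v _ => Finset.sum_congr rfl fun s _ => (hkF v s).symm
    _ = _ := (Finset.sum_subtype _ (fun v => by
        rw [Set.Finite.mem_toFinset]; rfl) fun v => ∑ s, F.kappa s r v).symm
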